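/- For $(r_1,r_2)\in\mathbb{Q}^2\setminus\mathbb{Z}^2$ and $\tau$ in the upper half plane, put $q=e^{2\pi i\tau}$, $q_z=e^{2\pi i z}$ with $z=r_1\tau+r_2$, and let $$\kappa_{(r_1,r_2)}(\tau)=e^{\pi i r_2(r_1-1)}\,q^{\frac12 r_1(r_1-1)}\,(1-q_z)\prod_{n=1}^{\infty}(1-q^nq_z)(1-q^nq_z^{-1})(1-q^n)^{-2}$$ be the Klein form. Let $p$ be a prime and $r\ge 1$ an integer with $p^r>3$. Define $$\kappa(\tau)=\begin{cases}\kappa_{(\frac{p^r-1}{p^r},0)}(p^r\tau)^{-2}\,\kappa_{(\frac{p^{r-1}}{p^r},0)}(p^r\tau)^{-2}\,\kappa_{(\frac{1}{p^r},0)}(p^r\tau)^{2}&\text{if } r\ge 2,\\[4pt] \kappa_{(\frac15,0)}(5\tau)^{4}\,\kappa_{(\frac25,0)}(5\tau)^{-2}\,\kappa_{(\frac35,0)}(5\tau)^{-4}&\text{if } r=1,\ p=5,\\[4pt] \kappa_{(\frac3p,0)}(p\tau)^{-2}\,\kappa_{(\frac4p,0)}(p\tau)^{-2}\,\kappa_{(\frac5p,0)}(p\tau)^{2}&\text{if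 } r=1,\ p>5.\end{cases}$$ Then: 1. $\kappa$ is a (holomorphic) modular form of weight $2$ and level $\Gamma_1(p^r)$. 2. The $q$-expansion of $\kappa$ at the cusp $\infty$ lies in $\mathbb{Z}[[q]]$. 3. Let $\zeta_{p^r}=e^{2\pi i/p^r}$, $\pi=1-\zeta_{p^r}$, and let $\nu_\pi$ be the $\pi$-adic valuation on $\mathbb{Q}(\zeta_{p^r})$, normalized by $\nu_\pi(\pi)=1$ (and $\nu_\pi(0)=\infty$). For every $\alpha\in\mathrm{SL}_2(\mathbb{Z})$ with $\alpha\cdot\infty=0$, the $q$-expansion of $\kappa|[\alpha]_2$ in powers of $q^{1/p^r}$ (a $q$-expansion of $\kappa$ at the cusp $0$) has all its coefficients in $\mathbb{Q}(\zeta_{p^r})$, and the minimum of $\nu_\pi$ over these coefficients exists and equals $$\nu_0(\kappa)=-2p^{r-1}(pr-r+1).$$ -/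

import Mathlib

open scoped MatrixGroups ModularForm UpperHalfPlane NumberField CongruenceSubgroup

noncomputable section

/-- The Klein form `κ_{(r₁, r₂)}(τ)`, with `q ^ s = exp (2 π i s τ)` and
`q_z = exp (2 π i z)` where `z = r₁ τ + r₂`:
`e^{π i r₂ (r₁ - 1)} q^{r₁ (r₁ - 1) / 2} (1 - q_z)
  ∏_{n ≥ 1} (1 - q^n q_z) (1 - q^n q_z⁻¹) (1 - q^n)⁻²`.
It is used for `τ` in the upper half plane. -/
def kleinForm (r₁ r₂ : ℚ) (τ : ℂ) : ℂ :=
  let q : ℂ := Complex.exp (2 * Real.pi * Complex.I * τ)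
  let qz : ℂ := Complex.exp (2 * Real.pi * Complex.I * (r₁ * τ + r₂))
  Complex.exp (Real.pi * Complex.I * (r₂ * (r₁ - 1))) *
    Complex.exp (2 * Real.pi * Complex.I * (r₁ * (r₁ - 1) / 2 * τ)) * (1 - qz) *
    ∏' n : ℕ, ((1 - q ^ (n + 1) * qz) * (1 - q ^ (n + 1) * qz⁻¹) * ((1 - q ^ (n + 1)) ^ 2)⁻¹)

/-- `κ_{(t / N, 0)}(N τ)`. -/
def kleinAt (N t : ℕ) (τ : ℍ) : ℂ := kleinForm ((t : ℚ) / N) 0 ((N : ℂ) * τ)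

/-- The explicit product of Klein forms attached to a prime power `p ^ r > 3`. -/
def kleinProduct (p r : ℕ) (τ : ℍ) : ℂ :=
  if 2 ≤ r then
    kleinAt (p ^ r) (p ^ r - 1) τ ^ (-2 : ℤ) * kleinAt (p ^ r) (p ^ (r - 1)) τ ^ (-2 : ℤ) *
      kleinAt (p ^ r) 1 τ ^ (2 : ℤ)
  else if p = 5 then
    kleinAt 5 1 τ ^ (4 : ℤ) * kleinAt 5 2 τ ^ (-2 : ℤ) * kleinAt 5 3 τ ^ (-4 : ℤ)
  else
    kleinAt p 3 τ ^ (-2 : ℤ) * kleinAt p 4 τ ^ (-2 : ℤ) * kleinAt p 5 τ ^ (2 : ℤ)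

/-- The root of unity `ζ_n = exp (2 π i / n)` in `ℂ`. -/
def zetaC (n : ℕ) : ℂ := Complex.exp (2 * Real.pi * Complex.I / n)

/-- The cyclotomic field `ℚ(ζ_n)` as a subfield of `ℂ`. -/
abbrev cycField (n : ℕ) : IntermediateField ℚ ℂ := IntermediateField.adjoin ℚ {zetaC n}

theorem zetaC_isPrimitiveRoot (n : ℕ) (hn : n ≠ 0) : IsPrimitiveRoot (zetaC n) n :=
  Complex.isPrimitiveRoot_exp n hn

theorem zetaC_isIntegral (n : ℕ) : IsIntegral ℤ (zetaC n) := by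
  rcases Nat.eq_zero_or_pos n with rfl | hn
  · simpa [zetaC] using (isIntegral_one : IsIntegral ℤ (1 : ℂ))
  · exact (zetaC_isPrimitiveRoot n hn.ne').isIntegral hn

instance cycField_numberField (n : ℕ) : NumberField (cycField n) where
  to_charZero := inferInstance
  to_finiteDimensional :=
    IntermediateField.adjoin.finiteDimensional ((zetaC_isIntegral n).tower_top)

/-- `ζ_n` as an element of the ring of integers of `ℚ(ζ_n)`. -/
def zetaInt (n : ℕ) : 𝓞 (cycField n) :=
  ⟨⟨zetaC n, IntermediateField.mem_adjoin_simple_self ℚ (zetaC n)⟩,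
    (isIntegral_algHom_iff ((cycField n).val.restrictScalars ℤ)
      (cycField n).val.injective).1 (zetaC_isIntegral n)⟩

theorem one_sub_zetaInt_prime (p r : ℕ) (hp : p.Prime) (hr : 1 ≤ r) :
    Prime (1 - zetaInt (p ^ r)) := by
  obtain ⟨k, rfl⟩ : ∃ k, r = k + 1 := ⟨r - 1, by omega⟩
  have : Fact p.Prime := ⟨hp⟩
  have hn : p ^ (k + 1) ≠ 0 := pow_ne_zero _ hp.ne_zero
  have : NeZero (p ^ (k + 1)) := ⟨hn⟩
  have h := zetaC_isPrimitiveRoot (p ^ (k + 1)) hn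
  have : IsCyclotomicExtension {p ^ (k + 1)} ℚ (cycField (p ^ (k + 1))) :=
    by
      change IsCyclotomicExtension {p ^ (k + 1)} ℚ (cycField (p ^ (k + 1))).toSubalgebra
      rw [IntermediateField.adjoin_simple_toSubalgebra_of_isAlgebraic
        ((zetaC_isIntegral _).tower_top (A := ℚ)).isAlgebraic]
      exact h.adjoin_isCyclotomicExtension ℚ
  have hζ : IsPrimitiveRoot ((zetaInt (p ^ (k + 1)) : 𝓞 (cycField (p ^ (k + 1)))) :
      cycField (p ^ (k + 1))) (p ^ (k + 1)) :=
    IsPrimitiveRoot.of_map_of_injective (f := (cycField (p ^ (k + 1))).val) h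
      (cycField (p ^ (k + 1))).val.injective
  have h2 := hζ.zeta_sub_one_prime
  rw [← neg_sub]
  exact h2.neg

/-- The prime ideal `(π)`, `π = 1 - ζ_{p ^ r}`, of the ring of integers of `ℚ(ζ_{p ^ r})`. -/
def piIdeal (p r : ℕ) (hp : p.Prime) (hr : 1 ≤ r) :
    IsDedekindDomain.HeightOneSpectrum (𝓞 (cycField (p ^ r))) where
  asIdeal := Ideal.span {1 - zetaInt (p ^ r)}
  isPrime := (Ideal.span_singleton_prime (one_sub_zetaInt_prime p r hp hr).ne_zero).2
    (one_sub_zetaInt_prime p r hp hr)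
  ne_bot := by
    simpa [Ideal.span_singleton_eq_bot] using (one_sub_zetaInt_prime p r hp hr).ne_zero

/-- The additive `π`-adic valuation on `ℚ(ζ_{p ^ r})`, with `ν(0) = ∞` and `ν(π) = 1`. -/
def nuPi (p r : ℕ) (hp : p.Prime) (hr : 1 ≤ r) (x : cycField (p ^ r)) : WithTop ℤ :=
  open Classical in
  if x = 0 then ⊤
  else ((-WithZero.log ((piIdeal p r hp hr).valuation (cycField (p ^ r)) x) : ℤ) : WithTop ℤ)

end

/-! ### Infinite products and q-Pochhammer symbols -/

section InfiniteProducts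

open Filter Topology

/-! Everything rests on one transformation law, `klein_transform`: under `SL(2, ℤ)` a Klein form has
weight `-1`, and the matrix acts on its characteristic `(x, y)` from the right. The law comes from
Liouville's theorem. The theta functions attached to `τ` and to `γτ`, the latter rescaled and
multiplied by a Gaussian, are entire in `z` with compatible zeros. The modulus of a Klein form is
periodic in its characteristic, so one function is bounded by a multiple of the other on all of `ℂ`
as soon as this holds on one cell. Hence they are proportional, and the derivatives at `0` give the
constant. Real characteristics are used so that `xτ + y` runs over the whole plane.

All three products are of the shape `∏ κ_{(t/N, 0)}(Nτ) ^ (2e)`, and `KleinDatum` isolates what is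
needed of `t` and `e`. The condition `∑ e = -1` gives weight two. The condition `N ∣ ∑ e t²` cancels
the roots of unity that arise when an element of `Γ₁(N)` shifts the characteristics by integers. A
Klein form has order `-{x}(1 - {x})/2` at `∞`, so `nonpos` gives nonnegative order at every cusp:
`form_slash` writes each slash of the form as a product of Klein forms with characteristics `(ta/N,
tb/N)` at an upper triangular image of `τ`.

At `∞` the form is a power of `q` times Euler products with constant term `1` and integer
coefficients. At `0` it is `C · Φ(q^{1/N})`, where `Φ` has constant term `1` and coefficients in the
ring of integers of `ℚ(ζ_N)`. So the minimal valuation is that of `C = N⁻² ∏ (w⁻¹ (1 - w)²)^e`, with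
`w = ζ^{±t}`. It is computed from `ν(p) = p^{r-1}(p-1)` and from `ν(1 - w)`, which is `1` for `w` of
order `p^r` and `p^{r-1}` for `w` of order `p`. -/

theorem tendstoLocallyUniformlyOn_tprod_one_sub {U : Set ℂ} (hU : IsOpen U) {f : ℕ → ℂ → ℂ}
    (hf : ∀ n, DifferentiableOn ℂ (f n) U)
    (hb : ∀ K ⊆ U, IsCompact K → ∃ u : ℕ → ℝ, Summable u ∧ ∀ n, ∀ z ∈ K, ‖f n z‖ ≤ u n) :
    TendstoLocallyUniformlyOn (fun M z => ∏ n ∈ Finset.range M, (1 - f n z))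
      (fun z => ∏' n, (1 - f n z)) atTop U := by
  have h : HasProdLocallyUniformlyOn (fun n z => 1 - f n z) (fun z => ∏' n, (1 - f n z)) U := by
    refine hasProdLocallyUniformlyOn_of_forall_compact hU fun K hKU hK => ?_
    obtain ⟨u, hu, hfu⟩ := hb K hKU hK
    simp_rw [sub_eq_add_neg]
    refine hu.hasProdUniformlyOn_nat_one_add (f := fun n z => -f n z) hK
      (Eventually.of_forall fun n z hz => ?_) fun n => ((hf n).continuousOn.mono hKU).neg
    rw [norm_neg]
    exact hfu n z hz
  have h2 := h.tendstoLocallyUniformlyOn_finsetRange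
  convert h2 using 1

theorem differentiableOn_finset_prod_one_sub {U : Set ℂ} {f : ℕ → ℂ → ℂ}
    (hf : ∀ n, DifferentiableOn ℂ (f n) U) (M : ℕ) :
    DifferentiableOn ℂ (fun z => ∏ n ∈ Finset.range M, (1 - f n z)) U := by
  have := DifferentiableOn.finsetProd (u := Finset.range M) (f := fun n z => 1 - f n z) (s := U)
    (𝕜 := ℂ) (fun n _ => (differentiableOn_const (c := (1 : ℂ))).fun_sub (hf n))
  refine this.congr fun z _ => ?_
  simp [Finset.prod_apply]

theorem differentiableOn_tprod_one_sub {U : Set ℂ} (hU : IsOpen U) {f : ℕ → ℂ → ℂ}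
    (hf : ∀ n, DifferentiableOn ℂ (f n) U)
    (hb : ∀ K ⊆ U, IsCompact K → ∃ u : ℕ → ℝ, Summable u ∧ ∀ n, ∀ z ∈ K, ‖f n z‖ ≤ u n) :
    DifferentiableOn ℂ (fun z => ∏' n, (1 - f n z)) U :=
  (tendstoLocallyUniformlyOn_tprod_one_sub hU hf hb).differentiableOn
    (Eventually.of_forall (differentiableOn_finset_prod_one_sub hf)) hU

theorem summable_norm_mul_pow {q : ℂ} (hq : ‖q‖ < 1) (w : ℂ) :
    Summable fun n : ℕ => ‖w * q ^ n‖ := by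
  simp_rw [norm_mul, norm_pow]
  exact (summable_geometric_of_lt_one (norm_nonneg _) hq).mul_left _

/-- The infinite `q`-Pochhammer symbol `(w; q)_∞ = ∏_{n ≥ 0} (1 - w q ^ n)`. -/
noncomputable def qPoch (w q : ℂ) : ℂ := ∏' n : ℕ, (1 - w * q ^ n)

theorem multipliable_qPoch {q : ℂ} (hq : ‖q‖ < 1) (w : ℂ) :
    Multipliable fun n : ℕ => 1 - w * q ^ n := by
  simp_rw [sub_eq_add_neg]
  refine multipliable_one_add_of_summable ?_
  simpa using summable_norm_mul_pow hq w

theorem qPoch_eq_one_sub_mul {q : ℂ} (hq : ‖q‖ < 1) (w : ℂ) :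
    qPoch w q = (1 - w) * qPoch (q * w) q := by
  rw [qPoch, tprod_eq_zero_mul']
  · rw [qPoch]
    simp only [pow_zero, mul_one]
    congr 1
    refine tprod_congr fun n => ?_
    ring
  · refine (multipliable_qPoch hq (w * q)).congr fun n => ?_
    ring

theorem qPoch_ne_zero {q w : ℂ} (hq : ‖q‖ < 1) (hw : ‖w‖ < 1) : qPoch w q ≠ 0 := by
  rw [qPoch]
  simp_rw [sub_eq_add_neg]
  refine tprod_one_add_ne_zero_of_summable (fun n h => ?_) ?_
  · have h1 : w * q ^ n = 1 := by linear_combination -h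
    have h2 : ‖w * q ^ n‖ < 1 := by
      rw [norm_mul, norm_pow]
      exact mul_lt_one_of_nonneg_of_lt_one_left (norm_nonneg _) hw
        (pow_le_one₀ (norm_nonneg _) hq.le)
    rw [h1] at h2
    simp at h2
  · simpa using summable_norm_mul_pow hq w

theorem qPoch_ne_zero' {q w : ℂ} (hq : ‖q‖ < 1) (hw : ‖q * w‖ < 1) (hw1 : w ≠ 1) :
    qPoch w q ≠ 0 := by
  rw [qPoch_eq_one_sub_mul hq]
  exact mul_ne_zero (sub_ne_zero.2 hw1.symm) (qPoch_ne_zero hq hw)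

theorem differentiableOn_qPoch {U : Set ℂ} (hU : IsOpen U) {w q : ℂ → ℂ}
    (hw : DifferentiableOn ℂ w U) (hq : DifferentiableOn ℂ q U) (hq1 : ∀ z ∈ U, ‖q z‖ < 1) :
    DifferentiableOn ℂ (fun z => qPoch (w z) (q z)) U := by
  refine differentiableOn_tprod_one_sub hU (f := fun n z => w z * q z ^ n)
    (fun n => hw.fun_mul (hq.fun_pow n)) fun K hKU hK => ?_
  rcases K.eq_empty_or_nonempty with rfl | hne
  · exact ⟨0, summable_zero, by simp⟩
  obtain ⟨z₀, hz₀, h₀⟩ := hK.exists_isMaxOn hne (hw.continuousOn.mono hKU).norm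
  obtain ⟨z₁, hz₁, h₁⟩ := hK.exists_isMaxOn hne (hq.continuousOn.mono hKU).norm
  refine ⟨fun n => ‖w z₀‖ * ‖q z₁‖ ^ n,
    (summable_geometric_of_lt_one (norm_nonneg _) (hq1 _ (hKU hz₁))).mul_left _,
    fun n z hz => ?_⟩
  rw [norm_mul, norm_pow]
  have a : ‖w z‖ ≤ ‖w z₀‖ := h₀ hz
  have b : ‖q z‖ ≤ ‖q z₁‖ := h₁ hz
  exact mul_le_mul a (pow_le_pow_left₀ (norm_nonneg _) b n) (by positivity) (norm_nonneg _)

theorem tendsto_qPoch {α : Type*} {l : Filter α} {w q : α → ℂ} {w₀ : ℂ}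
    (hw : Tendsto w l (𝓝 w₀)) (hq : Tendsto q l (𝓝 0)) :
    Tendsto (fun a => qPoch (w a) (q a)) l (𝓝 (1 - w₀)) := by
  have key : Tendsto (fun a => ∏' n : ℕ, (1 + -(w a * q a ^ n))) l
      (𝓝 (∏' n : ℕ, (1 + -(w₀ * 0 ^ n)))) := by
    refine tendsto_tprod_one_add_of_dominated_convergence
      (bound := fun n => (‖w₀‖ + 1) * (1 / 2) ^ n) (summable_geometric_two.mul_left _)
      (fun n => ((hw.mul (hq.pow n)).neg)) ?_
    have h1 : ∀ᶠ a in l, ‖w a‖ < ‖w₀‖ + 1 :=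
      hw.norm.eventually (gt_mem_nhds (by linarith))
    have h2 : ∀ᶠ a in l, ‖q a‖ < 1 / 2 :=
      hq.norm.eventually (gt_mem_nhds (by simp))
    filter_upwards [h1, h2] with a ha hb n
    rw [norm_neg, norm_mul, norm_pow]
    gcongr
  -- Only the factor `n = 0` survives, since `0 ^ 0 = 1`.
  have e : ∏' n : ℕ, (1 + -(w₀ * 0 ^ n)) = 1 - w₀ := by
    rw [tprod_eq_mulSingle 0]
    · simp [sub_eq_add_neg]
    · intro n hn
      simp [hn]
  rw [e] at key
  simpa only [qPoch, sub_eq_add_neg] using key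

end InfiniteProducts

/-! ### A Liouville theorem for proportional entire functions -/

section Liouville

open Filter Topology

/-- Two entire functions, one dominated by a multiple of the other, are proportional. -/
theorem exists_eq_const_mul_of_norm_le {H G : ℂ → ℂ} (hH : Differentiable ℂ H)
    (hG : Differentiable ℂ G) {M : ℝ} (h : ∀ z, ‖H z‖ ≤ M * ‖G z‖) :
    ∃ c : ℂ, ∀ z, H z = c * G z := by
  by_cases hG0 : ∀ z, G z = 0
  · exact ⟨0, fun z => by simpa [hG0] using h z⟩
  push Not at hG0
  obtain ⟨z₁, hz₁⟩ := hG0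
  have hGa : AnalyticOnNhd ℂ G Set.univ := fun z _ => hG.analyticAt z
  have hne : ∀ z, ∀ᶠ w in 𝓝[≠] z, G w ≠ 0 := by
    intro z
    rcases (hG.analyticAt z).eventually_eq_zero_or_eventually_ne_zero with h0 | h0
    · have := hGa.eqOn_zero_of_preconnected_of_eventuallyEq_zero isPreconnected_univ
        (Set.mem_univ z) h0
      exact absurd (this (Set.mem_univ z₁)) hz₁
    · exact h0
  -- At zeros of `G` the quotient takes the default value `0`, so the bound holds everywhere and the
  -- singularities are removable.
  have hbd : ∀ w, ‖H w / G w‖ ≤ |M| := by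
    intro w
    by_cases hw : G w = 0
    · simp [hw]
    · rw [norm_div, div_le_iff₀ (norm_pos_iff.2 hw)]
      exact (h w).trans (by gcongr; exact le_abs_self M)
  set F : ℂ → ℂ := fun w => H w / G w with hF
  have hFd : ∀ w, G w ≠ 0 → DifferentiableAt ℂ F w := fun w hw => (hH w).fun_div (hG w) hw
  have hlim : ∀ z, Tendsto F (𝓝[≠] z) (𝓝 (limUnder (𝓝[≠] z) F)) := by
    intro z
    refine Complex.tendsto_limUnder_of_differentiable_on_punctured_nhds_of_bounded_under
      ((hne z).mono hFd) ?_
    refine ⟨|M| + |M|, eventually_map.2 (Eventually.of_forall fun w => ?_)⟩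
    exact (norm_sub_le _ _).trans (add_le_add (hbd w) (hbd z))
  set Q : ℂ → ℂ := fun z => limUnder (𝓝[≠] z) F with hQ
  have hQF : ∀ w, G w ≠ 0 → Q w = F w := fun w hw =>
    tendsto_nhds_unique (hlim w) ((hFd w hw).continuousAt.tendsto.mono_left nhdsWithin_le_nhds)
  have hQFe : ∀ z, Q =ᶠ[𝓝[≠] z] F := fun z => (hne z).mono hQF
  have hQd : Differentiable ℂ Q := by
    intro z
    refine (Complex.analyticAt_of_differentiable_on_punctured_nhds_of_continuousAt ?_
      ?_).differentiableAt
    · have hopen : IsOpen {w | G w ≠ 0} := isOpen_ne_fun hG.continuous continuous_const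
      refine (hne z).mono fun w hw => (hFd w hw).congr_of_eventuallyEq ?_
      filter_upwards [hopen.mem_nhds hw] with v hv using hQF v hv
    · rw [continuousAt_iff_punctured_nhds]
      exact (hlim z).congr' (hQFe z).symm
  have hQb : ∀ z, ‖Q z‖ ≤ |M| := fun z =>
    le_of_tendsto (hlim z).norm (Eventually.of_forall hbd)
  have hconst : ∀ z, Q z = Q z₁ := fun z =>
    hQd.apply_eq_apply_of_bounded
      (isBounded_iff_forall_norm_le.2 ⟨|M|, by rintro _ ⟨z, rfl⟩; exact hQb z⟩) z z₁
  refine ⟨Q z₁, fun z => ?_⟩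
  by_cases hz : G z = 0
  · have := h z
    rw [hz, norm_zero, mul_zero, norm_le_zero_iff] at this
    rw [this, hz, mul_zero]
  · rw [← hconst z, hQF z hz]
    simp only [hF]
    field_simp

end Liouville

/-! ### Theta functions and Klein forms with real characteristics -/

section Theta

open Filter Topology Complex
open scoped Real

/-- `e(z) = exp (2 π i z)`. -/
noncomputable def e2pi (z : ℂ) : ℂ := exp (2 * π * I * z)

theorem e2pi_add (z w : ℂ) : e2pi (z + w) = e2pi z * e2pi w := by
  rw [e2pi, mul_add, exp_add, e2pi, e2pi]

theorem e2pi_neg (z : ℂ) : e2pi (-z) = (e2pi z)⁻¹ := by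
  rw [e2pi, mul_neg, exp_neg, e2pi]

theorem e2pi_ne_zero (z : ℂ) : e2pi z ≠ 0 := exp_ne_zero _

@[simp] theorem e2pi_zero : e2pi 0 = 1 := by simp [e2pi]

@[simp] theorem e2pi_intCast (n : ℤ) : e2pi n = 1 := by
  rw [e2pi, mul_comm]
  exact exp_int_mul_two_pi_mul_I n

@[simp] theorem e2pi_one : e2pi 1 = 1 := by simpa using e2pi_intCast 1

theorem e2pi_eq_one_iff {z : ℂ} : e2pi z = 1 ↔ ∃ n : ℤ, z = n := by
  rw [e2pi, exp_eq_one_iff]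
  refine exists_congr fun n => ?_
  rw [mul_comm]
  constructor
  · exact fun h => mul_right_cancel₀ two_pi_I_ne_zero h
  · exact fun h => by rw [h]

theorem e2pi_zpow (z : ℂ) (n : ℤ) : e2pi z ^ n = e2pi (n * z) := by
  rw [e2pi, ← exp_int_mul, e2pi]
  ring_nf

theorem e2pi_pow (z : ℂ) (n : ℕ) : e2pi z ^ n = e2pi (n * z) := by
  rw [← zpow_natCast, e2pi_zpow]
  simp

theorem norm_e2pi (z : ℂ) : ‖e2pi z‖ = Real.exp (-2 * π * z.im) := by
  rw [e2pi, norm_exp]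
  simp

theorem norm_e2pi_lt_one {z : ℂ} (hz : 0 < z.im) : ‖e2pi z‖ < 1 := by
  rw [norm_e2pi, Real.exp_lt_one_iff]
  have := Real.pi_pos
  nlinarith [mul_pos this hz]

@[fun_prop]
theorem differentiable_e2pi : Differentiable ℂ e2pi := by
  unfold e2pi
  fun_prop

/-- The theta function `(w; q)_∞ (q / w; q)_∞ / (q; q)_∞ ^ 2`. -/
noncomputable def thetaQ (q w : ℂ) : ℂ := qPoch w q * qPoch (q * w⁻¹) q / qPoch q q ^ 2

theorem thetaQ_mul {q w : ℂ} (hq : ‖q‖ < 1) (hq0 : q ≠ 0) (hw : w ≠ 0) :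
    thetaQ q (q * w) = -w⁻¹ * thetaQ q w := by
  have h1 : q * (q * w)⁻¹ = w⁻¹ := by field_simp
  rw [thetaQ, thetaQ, h1, qPoch_eq_one_sub_mul hq w, qPoch_eq_one_sub_mul hq w⁻¹]
  field_simp
  ring

theorem thetaQ_ne_zero {q w : ℂ} (hq : ‖q‖ < 1) (h1 : ‖q * w‖ < 1) (h2 : ‖q * w⁻¹‖ < 1)
    (hw : w ≠ 1) : thetaQ q w ≠ 0 :=
  div_ne_zero (mul_ne_zero (qPoch_ne_zero' hq h1 hw) (qPoch_ne_zero hq h2))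
    (pow_ne_zero 2 (qPoch_ne_zero hq hq))

/-- The function `exp (-π i z) θ(e(τ), e(z))`, an odd entire function of `z` which vanishes exactly
at the points of the lattice `ℤ τ + ℤ`. -/
noncomputable def thetaG (τ z : ℂ) : ℂ := exp (-(π * I * z)) * thetaQ (e2pi τ) (e2pi z)

theorem differentiable_qPoch_e2pi {τ : ℂ} (hτ : 0 < τ.im) {g : ℂ → ℂ} (hg : Differentiable ℂ g) :
    Differentiable ℂ fun z => qPoch (g z) (e2pi τ) := by
  rw [← differentiableOn_univ]
  exact differentiableOn_qPoch isOpen_univ hg.differentiableOn (differentiableOn_const _)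
    fun _ _ => norm_e2pi_lt_one hτ

theorem differentiable_thetaG {τ : ℂ} (hτ : 0 < τ.im) : Differentiable ℂ (thetaG τ) := by
  unfold thetaG thetaQ
  have h1 := differentiable_qPoch_e2pi hτ differentiable_e2pi
  have h2 := differentiable_qPoch_e2pi hτ (g := fun z => e2pi τ * (e2pi z)⁻¹) (by
    simp_rw [← e2pi_neg]
    fun_prop)
  fun_prop

theorem thetaG_zero {τ : ℂ} (hτ : 0 < τ.im) : thetaG τ 0 = 0 := by
  rw [thetaG, thetaQ, e2pi_zero, qPoch_eq_one_sub_mul (norm_e2pi_lt_one hτ) 1]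
  simp

/-- The zero at the origin comes from the single factor `1 - e(z)`; the cofactor `U` equals `1`
there. The derivative does not depend on `τ`, which is what later pins down the automorphy factor.
-/
theorem hasDerivAt_thetaG {τ : ℂ} (hτ : 0 < τ.im) :
    HasDerivAt (thetaG τ) (-(2 * π * I)) 0 := by
  have hq := norm_e2pi_lt_one hτ
  set U : ℂ → ℂ := fun z => exp (-(π * I * z)) *
    (qPoch (e2pi τ * e2pi z) (e2pi τ) * qPoch (e2pi τ * (e2pi z)⁻¹) (e2pi τ) /
      qPoch (e2pi τ) (e2pi τ) ^ 2) with hU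
  have hUd : Differentiable ℂ U := by
    have h1 := differentiable_qPoch_e2pi hτ (g := fun z => e2pi τ * e2pi z) (by fun_prop)
    have h2 := differentiable_qPoch_e2pi hτ (g := fun z => e2pi τ * (e2pi z)⁻¹) (by
      simp_rw [← e2pi_neg]
      fun_prop)
    simp only [hU]
    fun_prop
  have hU0 : U 0 = 1 := by
    have : qPoch (e2pi τ) (e2pi τ) ≠ 0 := qPoch_ne_zero hq hq
    simp only [hU, e2pi_zero, mul_one, inv_one, mul_zero, neg_zero, exp_zero, one_mul]
    field_simp
  have hG : thetaG τ = fun z => (1 - e2pi z) * U z := by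
    funext z
    rw [thetaG, thetaQ, qPoch_eq_one_sub_mul hq (e2pi z)]
    simp only [hU]
    ring
  have he : HasDerivAt e2pi (2 * π * I) 0 := by
    have := ((hasDerivAt_id (0 : ℂ)).const_mul (2 * π * I)).cexp
    simpa [e2pi] using! this
  have := (he.const_sub 1).fun_mul (hUd 0).hasDerivAt
  rw [hG]
  simpa [hU0] using this

/-- The Klein form with real characteristics. -/
noncomputable def klein (x y : ℝ) (τ : ℂ) : ℂ :=
  exp (π * I * ((x - 1) * (x * τ + y))) * thetaQ (e2pi τ) (e2pi (x * τ + y))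

theorem klein_eq_thetaG (x y : ℝ) (τ : ℂ) :
    klein x y τ = exp (π * I * (x * (x * τ + y))) * thetaG τ (x * τ + y) := by
  rw [klein, thetaG, ← mul_assoc (exp _) (exp _), ← exp_add]
  congr 2
  ring

theorem klein_add_one_right (x y : ℝ) (τ : ℂ) :
    klein x (y + 1) τ = -exp (π * I * x) * klein x y τ := by
  have h : e2pi (x * τ + (y + 1 : ℝ)) = e2pi (x * τ + y) := by
    rw [show (x * τ + (y + 1 : ℝ) : ℂ) = (x * τ + y) + 1 by push_cast; ring, e2pi_add, e2pi_one,
      mul_one]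
  have h2 : exp (π * I * ((x - 1) * (x * τ + (y + 1 : ℝ)))) =
      -exp (π * I * x) * exp (π * I * ((x - 1) * (x * τ + y))) := by
    rw [show (π * I * ((x - 1) * (x * τ + (y + 1 : ℝ))) : ℂ) =
      π * I * x + π * I * ((x - 1) * (x * τ + y)) - π * I by push_cast; ring, exp_sub, exp_add,
      exp_pi_mul_I]
    ring
  rw [klein, klein, h, h2, mul_assoc]

theorem klein_add_one_left (x y : ℝ) {τ : ℂ} (hτ : 0 < τ.im) :
    klein (x + 1) y τ = -exp (-(π * I * y)) * klein x y τ := by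
  have h : e2pi ((x + 1 : ℝ) * τ + y) = e2pi τ * e2pi (x * τ + y) := by
    rw [← e2pi_add]
    congr 1
    push_cast
    ring
  rw [klein, klein, h, thetaQ_mul (norm_e2pi_lt_one hτ) (e2pi_ne_zero _) (e2pi_ne_zero _),
    ← e2pi_neg, e2pi]
  have : exp (π * I * (((x + 1 : ℝ) - 1) * ((x + 1 : ℝ) * τ + y))) *
      exp (2 * π * I * -(x * τ + y)) =
      exp (-(π * I * y)) * exp (π * I * ((x - 1) * (x * τ + y))) := by
    rw [← exp_add, ← exp_add]
    congr 1
    push_cast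
    ring
  linear_combination -(thetaQ (e2pi τ) (e2pi (x * τ + y))) * this

/-- Integer shifts multiply a Klein form by exponentials of purely imaginary numbers, because the
characteristic is real. -/
theorem norm_klein_add_int (x y : ℝ) {τ : ℂ} (hτ : 0 < τ.im) (n m : ℤ) :
    ‖klein (x + n) (y + m) τ‖ = ‖klein x y τ‖ := by
  have h1 : ∀ y, Function.Periodic (fun x => ‖klein x y τ‖) 1 := fun y x => by
    simp only [klein_add_one_left x y hτ, norm_mul, norm_neg]
    rw [norm_exp]
    simp
  have h2 : ∀ x, Function.Periodic (fun y => ‖klein x y τ‖) 1 := fun x y => by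
    simp only [klein_add_one_right x y τ, norm_mul, norm_neg]
    rw [norm_exp]
    simp
  have a := (h1 (y + m)).int_mul n x
  have b := (h2 x).int_mul m y
  simp only [mul_one] at a b
  rw [a, b]

/-- Squaring removes the signs in the one-step shifts. This is why only even powers of Klein forms
are considered. -/
theorem klein_sq_add_int (x y : ℝ) {τ : ℂ} (hτ : 0 < τ.im) (n m : ℤ) :
    klein (x + n) (y + m) τ ^ 2 = e2pi (m * x - n * y) * klein x y τ ^ 2 := by
  have h1 : ∀ (n : ℤ) x y, klein (x + n) y τ ^ 2 = e2pi (-(n * y)) * klein x y τ ^ 2 := by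
    intro n x y
    have step : ∀ x, klein (x + 1) y τ ^ 2 = e2pi (-y) * klein x y τ ^ 2 := fun x => by
      rw [klein_add_one_left x y hτ, mul_pow, neg_sq, ← exp_nat_mul, e2pi]
      congr 2
      push_cast
      ring
    induction n using Int.induction_on with
    | zero => simp
    | succ k ih =>
      rw [show x + ((k : ℤ) + 1 : ℤ) = x + (k : ℤ) + 1 by push_cast; ring, step, ih, ← mul_assoc,
        ← e2pi_add]
      congr 2
      push_cast
      ring
    | pred k ih =>
      have := step (x + (-(k : ℤ) - 1 : ℤ))
      rw [show x + (-(k : ℤ) - 1 : ℤ) + 1 = x + (-(k : ℤ) : ℤ) by push_cast; ring, ih] at this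
      have e : e2pi (y : ℂ) * e2pi (-y) = 1 := by rw [← e2pi_add]; simp
      calc klein (x + (-(k : ℤ) - 1 : ℤ)) y τ ^ 2
          = e2pi y * (e2pi (-y) * klein (x + (-(k : ℤ) - 1 : ℤ)) y τ ^ 2) := by
            rw [← mul_assoc, e, one_mul]
        _ = _ := by
          rw [← this, ← mul_assoc, ← e2pi_add]
          congr 2
          push_cast
          ring
  have h2 : ∀ (m : ℤ) y, klein x (y + m) τ ^ 2 = e2pi (m * x) * klein x y τ ^ 2 := by
    intro m y
    have step : ∀ y, klein x (y + 1) τ ^ 2 = e2pi x * klein x y τ ^ 2 := fun y => by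
      rw [klein_add_one_right x y τ, mul_pow, neg_sq, ← exp_nat_mul, e2pi]
      congr 2
      push_cast
      ring
    induction m using Int.induction_on with
    | zero => simp
    | succ k ih =>
      rw [show y + ((k : ℤ) + 1 : ℤ) = y + (k : ℤ) + 1 by push_cast; ring, step, ih, ← mul_assoc,
        ← e2pi_add]
      congr 2
      push_cast
      ring
    | pred k ih =>
      have := step (y + (-(k : ℤ) - 1 : ℤ))
      rw [show y + (-(k : ℤ) - 1 : ℤ) + 1 = y + (-(k : ℤ) : ℤ) by push_cast; ring, ih] at this
      have e : e2pi (-x : ℂ) * e2pi x = 1 := by rw [← e2pi_add]; simp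
      calc klein x (y + (-(k : ℤ) - 1 : ℤ)) τ ^ 2
          = e2pi (-x) * (e2pi x * klein x (y + (-(k : ℤ) - 1 : ℤ)) τ ^ 2) := by
            rw [← mul_assoc, e, one_mul]
        _ = _ := by
          rw [← this, ← mul_assoc, ← e2pi_add]
          congr 2
          push_cast
          ring
  rw [h1, h2, ← mul_assoc, ← e2pi_add]
  congr 1
  -- The first shift sees `y + m` in place of `y`; the discrepancy `e(-nm)` is trivial.
  rw [← mul_one (e2pi (m * x - n * y)), ← e2pi_intCast (-(n * m)), ← e2pi_add]
  congr 1
  push_cast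
  ring

theorem thetaQ_e2pi_ne_zero {x y : ℝ} {τ : ℂ} (hτ : 0 < τ.im) (hx : |x| < 1)
    (h : x = 0 → ∀ m : ℤ, y ≠ m) : thetaQ (e2pi τ) (e2pi (x * τ + y)) ≠ 0 := by
  have h1 := abs_lt.1 hx
  refine thetaQ_ne_zero (norm_e2pi_lt_one hτ) ?_ ?_ ?_
  · rw [← e2pi_add]
    apply norm_e2pi_lt_one
    simp
    nlinarith
  · rw [← e2pi_neg, ← e2pi_add]
    apply norm_e2pi_lt_one
    simp
    nlinarith
  · intro h0
    obtain ⟨n, hn⟩ := e2pi_eq_one_iff.1 h0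
    have hi := congrArg Complex.im hn
    simp at hi
    have hx0 : x = 0 := hi.resolve_right hτ.ne'
    apply h hx0 n
    have hr := congrArg Complex.re hn
    simpa [hx0] using hr

theorem klein_ne_zero {x y : ℝ} {τ : ℂ} (hτ : 0 < τ.im)
    (h : ¬ ∃ n m : ℤ, x = n ∧ y = m) : klein x y τ ≠ 0 := by
  rw [← norm_ne_zero_iff]
  have e : ‖klein x y τ‖ = ‖klein (Int.fract x) y τ‖ := by
    have := norm_klein_add_int (Int.fract x) y hτ ⌊x⌋ 0
    simpa using this
  rw [e, norm_ne_zero_iff, klein]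
  refine mul_ne_zero (exp_ne_zero _) (thetaQ_e2pi_ne_zero hτ ?_ fun hx m hy => ?_)
  · rw [abs_of_nonneg (Int.fract_nonneg x)]
    exact Int.fract_lt_one x
  · refine h ⟨⌊x⌋, m, ?_, hy⟩
    have := Int.fract_add_floor x
    rw [hx] at this
    linarith

end Theta

/-! ### The transformation law under the modular group -/

section KleinTransformation

open Filter Topology Complex
open scoped Real

theorem exists_real_coords {τ : ℂ} (hτ : 0 < τ.im) (z : ℂ) : ∃ x y : ℝ, z = x * τ + y := by
  refine ⟨z.im / τ.im, z.re - z.im / τ.im * τ.re, Complex.ext ?_ ?_⟩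
  · simp
  · simp [hτ.ne']

theorem thetaG_ne_zero {τ : ℂ} (hτ : 0 < τ.im) {x y : ℝ} (hx : |x| < 1) (hy : |y| < 1)
    (hxy : ¬ (x = 0 ∧ y = 0)) : thetaG τ (x * τ + y) ≠ 0 := by
  refine mul_ne_zero (exp_ne_zero _) (thetaQ_e2pi_ne_zero hτ hx fun hx0 m hm => hxy ⟨hx0, ?_⟩)
  rw [hm] at hy ⊢
  have : |m| < 1 := by exact_mod_cast hy
  rw [Int.abs_lt_one_iff.1 this, Int.cast_zero]

/-- The Klein forms have weight `-1`: the modular group acts on the characteristic. -/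
theorem klein_transform {a b c d : ℤ} (hdet : a * d - b * c = 1) {τ τ' : ℂ} (hτ : 0 < τ.im)
    (hτ' : 0 < τ'.im) (hj : (c * τ + d : ℂ) ≠ 0) (hττ' : τ' = (a * τ + b) / (c * τ + d))
    (x y : ℝ) :
    klein x y τ' = (c * τ + d : ℂ)⁻¹ * klein (x * a + y * c) (x * b + y * d) τ := by
  have hdetC : (a * d - b * c : ℂ) = 1 := by exact_mod_cast hdet
  have hdetR : (a * d - b * c : ℝ) = 1 := by exact_mod_cast hdet
  set j : ℂ := c * τ + d with hjdef
  -- The Gaussian is chosen so that `H / thetaG τ` becomes the quotient of the Klein forms at `τ'`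
  -- and `τ`, as `hkH` shows.
  set H : ℂ → ℂ := fun z => exp (-(π * I * (c * z ^ 2 / j))) * thetaG τ' (z / j) with hH
  have hHd : Differentiable ℂ H := by
    have h1 := (differentiable_thetaG hτ').comp
      (show Differentiable ℂ fun z : ℂ => z / j by fun_prop)
    have h2 : Differentiable ℂ fun z : ℂ => exp (-(π * I * (c * z ^ 2 / j))) := by fun_prop
    exact h2.mul h1
  have hGd := differentiable_thetaG hτ
  have hz : ∀ x y : ℝ, ((x * a + y * c : ℝ) * τ + (x * b + y * d : ℝ) : ℂ) / j = x * τ' + y := by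
    intro x y
    rw [hττ', div_eq_iff hj, add_mul, mul_assoc, div_mul_cancel₀ _ hj, hjdef]
    push_cast
    ring
  have hkH : ∀ x y : ℝ, klein x y τ' =
      exp (π * I * ((x * a + y * c : ℝ) * ((x * a + y * c : ℝ) * τ + (x * b + y * d : ℝ)))) *
        H ((x * a + y * c : ℝ) * τ + (x * b + y * d : ℝ)) := by
    intro x y
    rw [klein_eq_thetaG]
    simp only [hH]
    rw [hz, ← mul_assoc (exp _) (exp _), ← exp_add]
    congr 2
    set z : ℂ := (x * a + y * c : ℝ) * τ + (x * b + y * d : ℝ) with hzdef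
    have hzj : x * τ' + y = z / j := (hz x y).symm
    rw [hzj]
    field_simp
    rw [hzdef, hjdef]
    push_cast
    linear_combination (-(x : ℂ)) * ((x * a + y * c) * τ + (x * b + y * d)) * hdetC
  have key : ∃ M : ℝ, ∀ x y : ℝ, |x| ≤ 1 / 2 → |y| ≤ 1 / 2 →
      ‖H (x * τ + y)‖ ≤ M * ‖thetaG τ (x * τ + y)‖ := by
    -- Both functions vanish at `0`, and for `thetaG τ` this is the only zero on the closed cell and
    -- it is simple. Dividing both by `z` makes the ratio continuous on a compact set.
    set Q : ℝ × ℝ → ℝ := fun p =>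
      ‖dslope H 0 (p.1 * τ + p.2)‖ / ‖dslope (thetaG τ) 0 (p.1 * τ + p.2)‖ with hQ
    have hne : ∀ x y : ℝ, |x| ≤ 1 / 2 → |y| ≤ 1 / 2 →
        dslope (thetaG τ) 0 (x * τ + y) ≠ 0 := by
      intro x y hx hy
      by_cases h0 : (x * τ + y : ℂ) = 0
      · rw [h0, dslope_same, (hasDerivAt_thetaG hτ).deriv]
        simp
      · rw [dslope_of_ne _ h0, slope_def_field, thetaG_zero hτ]
        refine div_ne_zero ?_ (by simpa using h0)
        rw [sub_zero]
        refine thetaG_ne_zero hτ (by linarith) (by linarith) fun h => h0 ?_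
        simp [h.1, h.2]
    have hcont : ContinuousOn Q (Set.Icc (-(1 / 2)) (1 / 2) ×ˢ Set.Icc (-(1 / 2)) (1 / 2)) := by
      have c1 : Continuous (dslope H 0) := by
        have := (differentiableOn_dslope (f := H) (s := Set.univ) (c := 0) univ_mem).2
          hHd.differentiableOn
        exact (differentiableOn_univ.1 this).continuous
      have c2 : Continuous (dslope (thetaG τ) 0) := by
        have := (differentiableOn_dslope (f := thetaG τ) (s := Set.univ) (c := 0) univ_mem).2
          hGd.differentiableOn
        exact (differentiableOn_univ.1 this).continuous
      have c3 : Continuous fun p : ℝ × ℝ => (p.1 * τ + p.2 : ℂ) := by fun_prop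
      refine ((c1.comp c3).norm.continuousOn).div ((c2.comp c3).norm.continuousOn) ?_
      rintro ⟨x, y⟩ ⟨hx, hy⟩
      exact norm_ne_zero_iff.2 (hne x y (abs_le.2 hx) (abs_le.2 hy))
    obtain ⟨M, hM⟩ := (isCompact_Icc.prod isCompact_Icc).bddAbove_image hcont
    refine ⟨M, fun x y hx hy => ?_⟩
    have hle : Q (x, y) ≤ M := hM ⟨(x, y), ⟨abs_le.1 hx, abs_le.1 hy⟩, rfl⟩
    have hH0 : H 0 = 0 := by simp [hH, thetaG_zero hτ']
    have e1 : ∀ z, H z = z * dslope H 0 z := fun z => by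
      have := sub_smul_dslope H 0 z
      rw [hH0] at this
      simpa using this.symm
    have e2 : ∀ z, thetaG τ z = z * dslope (thetaG τ) 0 z := fun z => by
      have := sub_smul_dslope (thetaG τ) 0 z
      rw [thetaG_zero hτ] at this
      simpa using this.symm
    rw [e1, e2, norm_mul, norm_mul]
    have hpos := norm_pos_iff.2 (hne x y hx hy)
    have := (div_le_iff₀ hpos).1 hle
    nlinarith [norm_nonneg (x * τ + y : ℂ)]
  obtain ⟨M, hM⟩ := key
  have hinv : ∀ x y : ℝ, (x * d - y * c) * a + (-(x * b) + y * a) * c = x ∧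
      (x * d - y * c) * b + (-(x * b) + y * a) * d = y := by
    intro x y
    exact ⟨by linear_combination x * hdetR, by linear_combination y * hdetR⟩
  have hkn : ∀ x y : ℝ, ‖klein (x * d - y * c) (-(x * b) + y * a) τ'‖ ≤ M * ‖klein x y τ‖ := by
    have base : ∀ x y : ℝ, |x| ≤ 1 / 2 → |y| ≤ 1 / 2 →
        ‖klein (x * d - y * c) (-(x * b) + y * a) τ'‖ ≤ M * ‖klein x y τ‖ := by
      intro x y hx hy
      rw [hkH, (hinv x y).1, (hinv x y).2, klein_eq_thetaG,
        norm_mul (exp (π * I * (x * (x * τ + y)))) (H (x * τ + y)),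
        norm_mul (exp (π * I * (x * (x * τ + y)))) (thetaG τ (x * τ + y)), mul_left_comm M]
      exact mul_le_mul_of_nonneg_left (hM x y hx hy) (norm_nonneg _)
    intro x y
    -- Any characteristic is moved into the cell by an integer vector. The inverse matrix is
    -- integral, so the transformed characteristic also moves by integers and both moduli are
    -- unchanged.
    have := base (x - round x) (y - round y) (abs_sub_round x) (abs_sub_round y)
    have e1 := norm_klein_add_int (x - round x) (y - round y) hτ (round x) (round y)
    have e2 := norm_klein_add_int ((x - round x) * d - (y - round y) * c)
      (-((x - round x) * b) + (y - round y) * a) hτ' (round x * d - round y * c)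
      (-(round x * b) + round y * a)
    rw [sub_add_cancel, sub_add_cancel] at e1
    rw [← e1, ← e2] at this
    convert this using 3
    · push_cast; ring
    · push_cast; ring
  have hdom : ∀ z, ‖H z‖ ≤ M * ‖thetaG τ z‖ := by
    intro z
    obtain ⟨x, y, rfl⟩ := exists_real_coords hτ z
    have := hkn x y
    rw [hkH, (hinv x y).1, (hinv x y).2, klein_eq_thetaG,
        norm_mul (exp (π * I * (x * (x * τ + y)))) (H (x * τ + y)),
        norm_mul (exp (π * I * (x * (x * τ + y)))) (thetaG τ (x * τ + y)), mul_left_comm M] at this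
    exact le_of_mul_le_mul_left this (norm_pos_iff.2 (exp_ne_zero _))
  obtain ⟨k, hk⟩ := exists_eq_const_mul_of_norm_le hHd hGd hdom
  have hkj : k = j⁻¹ := by
    have d1 : HasDerivAt H (-(2 * π * I) * j⁻¹) 0 := by
      have h1 : HasDerivAt (fun z : ℂ => exp (-(π * I * (c * z ^ 2 / j))))
          (deriv (fun z : ℂ => exp (-(π * I * (c * z ^ 2 / j)))) 0) 0 :=
        (show DifferentiableAt ℂ (fun z : ℂ => exp (-(π * I * (c * z ^ 2 / j)))) 0 by
          fun_prop).hasDerivAt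
      have h2 : HasDerivAt (fun z : ℂ => thetaG τ' (z / j)) (-(2 * π * I) * j⁻¹) 0 := by
        have h3 : HasDerivAt (fun z : ℂ => z / j) j⁻¹ 0 := by
          simpa using (hasDerivAt_id (0 : ℂ)).div_const j
        have h4 := hasDerivAt_thetaG hτ'
        rw [← zero_div j] at h4
        exact h4.comp (0 : ℂ) h3
      have := h1.fun_mul h2
      simpa [thetaG_zero hτ'] using this
    have d2 : HasDerivAt H (k * -(2 * π * I)) 0 := by
      have : H = fun z => k * thetaG τ z := funext hk
      rw [this]
      exact (hasDerivAt_thetaG hτ).const_mul k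
    have := d1.unique d2
    have h0 : (-(2 * π * I) : ℂ) ≠ 0 := neg_ne_zero.2 two_pi_I_ne_zero
    rw [mul_comm k] at this
    exact (mul_left_cancel₀ h0 this).symm
  rw [hkH, hk, hkj, klein_eq_thetaG]
  push_cast
  ring

end KleinTransformation

/-! ### Growth of Klein forms at infinity -/

section KleinAsymptotics

open Filter Topology Complex
open scoped Real

/-- The periodic function `{x} (1 - {x})`, which up to the factor `-1/2` is the order at `∞` of a
Klein form whose characteristic has first coordinate `x`. -/
noncomputable def fractBump (x : ℝ) : ℝ := Int.fract x * (1 - Int.fract x)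

theorem norm_klein_fract (x y : ℝ) {τ : ℂ} (hτ : 0 < τ.im) :
    ‖klein x y τ‖ = Real.exp (π * τ.im * fractBump x) *
      (‖exp (π * I * ((Int.fract x - 1) * y))‖ *
        ‖thetaQ (e2pi τ) (e2pi (Int.fract x * τ + y))‖) := by
  have e : ‖klein x y τ‖ = ‖klein (Int.fract x) y τ‖ := by
    have := norm_klein_add_int (Int.fract x) y hτ ⌊x⌋ 0
    simpa using this
  rw [e, klein, norm_mul, ← mul_assoc (Real.exp _)]
  congr 1
  rw [norm_exp, norm_exp, ← Real.exp_add, fractBump]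
  congr 1
  simp
  ring

theorem tendsto_e2pi_atImInfty : Tendsto (fun τ : ℍ => e2pi τ) UpperHalfPlane.atImInfty (𝓝 0) := by
  have := UpperHalfPlane.qParam_tendsto_atImInfty (h := 1) one_pos
  simpa [Function.Periodic.qParam, e2pi] using this

theorem tendsto_e2pi_mul_add_atImInfty {s : ℝ} (hs : 0 < s) (y : ℝ) :
    Tendsto (fun τ : ℍ => e2pi (s * τ + y)) UpperHalfPlane.atImInfty (𝓝 0) := by
  have := (UpperHalfPlane.qParam_tendsto_atImInfty (h := s⁻¹) (inv_pos.2 hs)).mul_const (e2pi y)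
  rw [zero_mul] at this
  refine this.congr fun τ => ?_
  rw [e2pi_add]
  congr 1
  simp [Function.Periodic.qParam, e2pi]
  ring_nf

/-- The leading term of a Klein form at the cusp `∞`. -/
theorem exists_tendsto_norm_klein {x y : ℝ} (h : ¬ ∃ n m : ℤ, x = n ∧ y = m) :
    ∃ c : ℝ, 0 < c ∧ Tendsto (fun τ : ℍ => ‖klein x y τ‖ * Real.exp (-(π * τ.im * fractBump x)))
      UpperHalfPlane.atImInfty (𝓝 c) := by
  set s := Int.fract x with hs
  have hs0 : 0 ≤ s := Int.fract_nonneg x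
  have hs1 : s < 1 := Int.fract_lt_one x
  have hq := tendsto_e2pi_atImInfty
  have hw' : Tendsto (fun τ : ℍ => e2pi τ * (e2pi (s * τ + y))⁻¹) UpperHalfPlane.atImInfty
      (𝓝 0) := by
    refine (tendsto_e2pi_mul_add_atImInfty (sub_pos.2 hs1) (-y)).congr fun τ => ?_
    rw [← e2pi_neg, ← e2pi_add]
    congr 1
    push_cast
    ring
  -- For `s > 0` the limit is `0`; for `s = 0` it is `e(y)`, which differs from `1` because the
  -- characteristic is not integral.
  have hw : ∃ w₀ : ℂ, w₀ ≠ 1 ∧ Tendsto (fun τ : ℍ => e2pi (s * τ + y)) UpperHalfPlane.atImInfty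
      (𝓝 w₀) := by
    rcases hs0.eq_or_lt with h0 | h0
    · refine ⟨e2pi y, fun h1 => ?_, ?_⟩
      · obtain ⟨m, hm⟩ := e2pi_eq_one_iff.1 h1
        refine h ⟨⌊x⌋, m, ?_, by exact_mod_cast hm⟩
        have := Int.fract_add_floor x
        rw [← hs, ← h0] at this
        linarith
      · simp only [← h0, ofReal_zero, zero_mul, zero_add]
        exact tendsto_const_nhds
    · exact ⟨0, zero_ne_one, tendsto_e2pi_mul_add_atImInfty h0 y⟩
  obtain ⟨w₀, hw₀, hw⟩ := hw
  have hθ : Tendsto (fun τ : ℍ => thetaQ (e2pi τ) (e2pi (s * τ + y))) UpperHalfPlane.atImInfty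
      (𝓝 ((1 - w₀) * (1 - 0) / (1 - 0) ^ 2)) :=
    ((tendsto_qPoch hw hq).mul (tendsto_qPoch hw' hq)).div ((tendsto_qPoch hq hq).pow 2) (by simp)
  refine ⟨_, ?_, (hθ.norm.const_mul ‖exp (π * I * ((s - 1) * y))‖).congr fun τ => ?_⟩
  · refine mul_pos (norm_pos_iff.2 (exp_ne_zero _)) (norm_pos_iff.2 ?_)
    simpa using sub_ne_zero.2 hw₀.symm
  · have h1 : Real.exp (π * τ.im * fractBump x) * Real.exp (-(π * τ.im * fractBump x)) = 1 := by
      rw [← Real.exp_add, add_neg_cancel, Real.exp_zero]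
    rw [norm_klein_fract x y (UpperHalfPlane.im_pos τ), UpperHalfPlane.coe_im]
    linear_combination (-(‖exp (π * I * ((s - 1) * y))‖ *
      ‖thetaQ (e2pi τ) (e2pi (s * τ + y))‖)) * h1

end KleinAsymptotics

/-! ### Products of Klein forms: level, cusps and boundedness -/

/-- The combinatorial data of a product of even powers of Klein forms
`κ_{(t / N, 0)}(N τ) ^ (2 e)` which is a modular form of weight two. -/
structure KleinDatum (N : ℕ) where
  t : Fin 3 → ℕ
  e : Fin 3 → ℤ
  pos : ∀ i, 0 < t i
  lt : ∀ i, t i < N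
  sum_e : ∑ i, e i = -1
  dvd : (N : ℤ) ∣ ∑ i, e i * (t i : ℤ) ^ 2
  nonpos : ∀ a : ℤ, ∑ i, (e i : ℝ) * fractBump (t i * a / N) ≤ 0

namespace KleinDatum

open Filter Topology Complex
open scoped Real

variable {N : ℕ} (D : KleinDatum N)

include D in
theorem N_pos : 0 < N := (D.pos 0).trans (D.lt 0)

/-- The product of Klein forms with characteristics `(t a / N, t b / N)`. -/
noncomputable def twist (a b : ℤ) (τ : ℂ) : ℂ :=
  ∏ i, klein (D.t i * a / N) (D.t i * b / N) τ ^ (2 * D.e i)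

/-- The product of the `κ_{(t / N, 0)}(N τ) ^ (2 e)`. -/
noncomputable def form (τ : ℍ) : ℂ := D.twist 1 0 (N * τ)

theorem not_int {a b c d : ℤ} (hdet : a * d - b * c = 1) (i : Fin 3) :
    ¬ ∃ n m : ℤ, (D.t i * a / N : ℝ) = n ∧ (D.t i * b / N : ℝ) = m := by
  rintro ⟨n, m, hn, hm⟩
  have hN : (N : ℝ) ≠ 0 := Nat.cast_ne_zero.2 D.N_pos.ne'
  rw [div_eq_iff hN] at hn hm
  have hn' : (D.t i : ℤ) * a = n * N := by exact_mod_cast hn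
  have hm' : (D.t i : ℤ) * b = m * N := by exact_mod_cast hm
  have : (N : ℤ) ∣ D.t i := ⟨n * d - m * c, by linear_combination -(D.t i : ℤ) * hdet + d * hn' - c * hm'⟩
  exact absurd (Nat.le_of_dvd (D.pos i) (Int.natCast_dvd_natCast.1 this)) (not_le.2 (D.lt i))

theorem twist_transform {a b c d : ℤ} (hdet : a * d - b * c = 1) {τ τ' : ℂ} (hτ : 0 < τ.im)
    (hτ' : 0 < τ'.im) (hj : (c * τ + d : ℂ) ≠ 0) (hττ' : τ' = (a * τ + b) / (c * τ + d)) :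
    D.twist 1 0 τ' = (c * τ + d : ℂ) ^ 2 * D.twist a b τ := by
  have h : ∀ i, klein (D.t i * (1 : ℤ) / N) (D.t i * (0 : ℤ) / N) τ' ^ (2 * D.e i) =
      ((c * τ + d : ℂ) ^ (-2 : ℤ)) ^ D.e i * klein (D.t i * a / N) (D.t i * b / N) τ ^ (2 * D.e i) := by
    intro i
    rw [klein_transform hdet hτ hτ' hj hττ', mul_zpow, inv_zpow', ← zpow_mul]
    congr 3
    · ring
    · push_cast; ring
    · push_cast; ring
  rw [twist, Finset.prod_congr rfl fun i _ => h i, Finset.prod_mul_distrib, Fin.prod_univ_three,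
    ← zpow_add₀ (zpow_ne_zero _ hj), ← zpow_add₀ (zpow_ne_zero _ hj), ← Fin.sum_univ_three, D.sum_e,
    ← zpow_mul, twist]
  norm_cast

/-- The expansion of the form at an arbitrary cusp. -/
theorem form_slash (γ : SL(2, ℤ)) {a b c d A B g : ℤ} (hdet : a * d - b * c = 1) (hA : 0 < A)
    (hg : 0 < g) (h00 : N * γ 0 0 = a * A) (h01 : N * γ 0 1 = a * B + b * g)
    (h10 : γ 1 0 = c * A) (h11 : γ 1 1 = c * B + d * g) (τ : ℍ) :
    (D.form ∣[(2 : ℤ)] γ) τ = (g : ℂ) ^ (-2 : ℤ) * D.twist a b ((A * τ + B) / g) := by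
  have hgC : (g : ℂ) ≠ 0 := Int.cast_ne_zero.2 hg.ne'
  have hgR : (0 : ℝ) < g := Int.cast_pos.2 hg
  have hAR : (0 : ℝ) < A := Int.cast_pos.2 hA
  have h00C : (N * γ 0 0 : ℂ) = a * A := by exact_mod_cast h00
  have h01C : (N * γ 0 1 : ℂ) = a * B + b * g := by exact_mod_cast h01
  have h10C : (γ 1 0 : ℂ) = c * A := by exact_mod_cast h10
  have h11C : (γ 1 1 : ℂ) = c * B + d * g := by exact_mod_cast h11
  -- The hypotheses say `diag(N, 1) γ = (a, b; c, d) (A, B; 0, g)`, and `τ₁` is the image of `τ`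
  -- under the triangular factor.
  set τ₁ : ℂ := (A * τ + B) / g with hτ₁
  have him : 0 < τ₁.im := by
    have : τ₁ = (A / g : ℝ) * τ + (B / g : ℝ) := by rw [hτ₁]; push_cast; ring
    rw [this]
    simp
    positivity
  have hden : (γ 1 0 * τ + γ 1 1 : ℂ) = g * (c * τ₁ + d) := by
    rw [hτ₁, h10C, h11C]
    field_simp
    ring
  have hden0 : (γ 1 0 * τ + γ 1 1 : ℂ) ≠ 0 := by
    have := UpperHalfPlane.denom_ne_zero γ τ
    simpa [UpperHalfPlane.denom] using this
  have hj : (c * τ₁ + d : ℂ) ≠ 0 := fun h => hden0 (by rw [hden, h, mul_zero])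
  have hcoe : ((γ • τ : ℍ) : ℂ) = (γ 0 0 * τ + γ 0 1) / (γ 1 0 * τ + γ 1 1) := by
    rw [UpperHalfPlane.coe_specialLinearGroup_apply]
    simp
  have hmob : (N * (γ • τ : ℍ) : ℂ) = (a * τ₁ + b) / (c * τ₁ + d) := by
    rw [hcoe, hden, ← mul_div_assoc, mul_add, ← mul_assoc, h00C, h01C, hτ₁, div_eq_div_iff
      (mul_ne_zero hgC (by rwa [← hτ₁])) (by rwa [← hτ₁])]
    field_simp
    ring
  have him' : 0 < (N * (γ • τ : ℍ) : ℂ).im := by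
    have := UpperHalfPlane.im_pos (γ • τ)
    have hN : (0 : ℝ) < N := Nat.cast_pos.2 D.N_pos
    simp only [Complex.mul_im, Complex.natCast_re, Complex.natCast_im, zero_mul, add_zero]
    exact mul_pos hN this
  have hdenom : UpperHalfPlane.denom γ τ = g * (c * τ₁ + d) := by
    rw [← hden]
    simp [UpperHalfPlane.denom]
  rw [ModularForm.SL_slash_apply, form, D.twist_transform hdet him him' hj hmob, hdenom,
    mul_zpow]
  have : (c * τ₁ + d : ℂ) ^ 2 * (c * τ₁ + d : ℂ) ^ (-2 : ℤ) = 1 := by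
    rw [zpow_neg]
    exact mul_inv_cancel₀ (pow_ne_zero 2 hj)
  linear_combination ((g : ℂ) ^ (-2 : ℤ) * D.twist a b τ₁) * this

/-- The characteristic `(t/N, 0)` moves by `(tk, tb)`, so each squared Klein form gains `e(b t² /
N)`. The total exponent is an integer by `dvd`. -/
theorem twist_eq_of_modEq (k b : ℤ) {τ : ℂ} (hτ : 0 < τ.im) :
    D.twist (1 + N * k) (N * b) τ = D.twist 1 0 τ := by
  have hN : (N : ℝ) ≠ 0 := Nat.cast_ne_zero.2 D.N_pos.ne'
  obtain ⟨m, hm⟩ := D.dvd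
  have h : ∀ i, klein (D.t i * (1 + N * k : ℤ) / N) (D.t i * (N * b : ℤ) / N) τ ^ (2 * D.e i) =
      e2pi (b * (D.e i * D.t i ^ 2) / N) *
        klein (D.t i * (1 : ℤ) / N) (D.t i * (0 : ℤ) / N) τ ^ (2 * D.e i) := by
    intro i
    have := klein_sq_add_int (D.t i * (1 : ℤ) / N) (D.t i * (0 : ℤ) / N) hτ (D.t i * k) (D.t i * b)
    rw [zpow_mul, zpow_mul, zpow_ofNat, zpow_ofNat]
    convert congrArg (· ^ D.e i) this using 1
    · congr 3
      · push_cast; field_simp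
      · push_cast; field_simp; ring
    · rw [mul_zpow, e2pi_zpow]
      congr 2
      push_cast
      ring
  rw [twist, Finset.prod_congr rfl fun i _ => h i, Finset.prod_mul_distrib, Fin.prod_univ_three,
    ← e2pi_add, ← e2pi_add, twist]
  have : (b * (D.e 0 * D.t 0 ^ 2) / N + b * (D.e 1 * D.t 1 ^ 2) / N + b * (D.e 2 * D.t 2 ^ 2) / N : ℂ)
      = (b * m : ℤ) := by
    have hm' : (∑ i, (D.e i : ℂ) * (D.t i : ℂ) ^ 2) = N * m := by exact_mod_cast hm
    have hNC : (N : ℂ) ≠ 0 := Nat.cast_ne_zero.2 D.N_pos.ne'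
    rw [Fin.sum_univ_three] at hm'
    rw [← add_div, ← add_div, div_eq_iff hNC]
    push_cast
    linear_combination b * hm'
  rw [this, e2pi_intCast, one_mul]

theorem form_slash_of_mem_Gamma1 {γ : SL(2, ℤ)} (hγ : γ ∈ CongruenceSubgroup.Gamma1 N) :
    D.form ∣[(2 : ℤ)] γ = D.form := by
  obtain ⟨h00, -, h10⟩ := (CongruenceSubgroup.Gamma1_mem N γ).1 hγ
  obtain ⟨c, hc⟩ := (ZMod.intCast_zmod_eq_zero_iff_dvd _ N).1 h10
  obtain ⟨k, hk⟩ : (N : ℤ) ∣ γ 0 0 - 1 := by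
    rw [← ZMod.intCast_zmod_eq_zero_iff_dvd]
    push_cast
    rw [h00, sub_self]
  have hN : (0 : ℤ) < N := Int.natCast_pos.2 D.N_pos
  have hdet := γ.det_coe
  rw [Matrix.det_fin_two] at hdet
  funext τ
  -- Here the triangular factor is `diag(N, 1)` itself: conjugation by it keeps `γ` integral because
  -- `N ∣ γ 1 0`.
  rw [D.form_slash γ (a := 1 + N * k) (b := N * γ 0 1) (c := c) (d := γ 1 1) (A := N) (B := 0)
    (g := 1) ?_ hN one_pos ?_ ?_ ?_ ?_, form]
  · rw [D.twist_eq_of_modEq]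
    · simp
    · have := UpperHalfPlane.im_pos τ
      have hN : (0 : ℝ) < N := Nat.cast_pos.2 D.N_pos
      simp
      positivity
  · linear_combination hdet - γ 1 1 * hk + γ 0 1 * hc
  · linear_combination N * hk
  · ring
  · linear_combination hc
  · ring

/-- Hermite normal form of `diag(M, 1) γ`: `A` is the gcd of the first column, and Bézout
coefficients complete the primitive column `(a, c)` to a unimodular matrix. -/
theorem exists_decomposition {M : ℤ} (hM : 0 < M) (γ : SL(2, ℤ)) :
    ∃ a b c d A B g : ℤ, a * d - b * c = 1 ∧ 0 < A ∧ 0 < g ∧ M * γ 0 0 = a * A ∧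
      M * γ 0 1 = a * B + b * g ∧ γ 1 0 = c * A ∧ γ 1 1 = c * B + d * g := by
  have hdet := γ.det_coe
  rw [Matrix.det_fin_two] at hdet
  have hne : M * γ 0 0 ≠ 0 ∨ γ 1 0 ≠ 0 := by
    by_contra! h
    have : γ 0 0 = 0 := (mul_eq_zero.1 h.1).resolve_left hM.ne'
    rw [this, h.2] at hdet
    simp at hdet
  obtain ⟨A, hA⟩ : ∃ A : ℤ, A = (Int.gcd (M * γ 0 0) (γ 1 0) : ℕ) := ⟨_, rfl⟩
  have hApos : 0 < A := by
    rw [hA, Int.natCast_pos, Int.gcd_pos_iff]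
    exact hne
  obtain ⟨a, ha⟩ : A ∣ M * γ 0 0 := hA ▸ Int.gcd_dvd_left ..
  obtain ⟨c, hc⟩ : A ∣ γ 1 0 := hA ▸ Int.gcd_dvd_right ..
  have hbez := Int.gcd_eq_gcd_ab (M * γ 0 0) (γ 1 0)
  set u := Int.gcdA (M * γ 0 0) (γ 1 0)
  set v := Int.gcdB (M * γ 0 0) (γ 1 0)
  have h1 : a * u + c * v = 1 := by
    refine mul_left_cancel₀ hApos.ne' ?_
    rw [← hA] at hbez
    linear_combination -hbez - u * ha - v * hc
  have hg : A * (a * γ 1 1 - c * (M * γ 0 1)) = M := by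
    linear_combination M * hdet - γ 1 1 * ha + M * γ 0 1 * hc
  refine ⟨a, -v, c, u, A, u * (M * γ 0 1) + v * γ 1 1, a * γ 1 1 - c * (M * γ 0 1),
    by linear_combination h1, hApos, ?_, by linear_combination ha, ?_, by linear_combination hc, ?_⟩
  · exact pos_of_mul_pos_right (by rw [hg]; exact hM) hApos.le
  · linear_combination (-(M * γ 0 1)) * h1
  · linear_combination (-γ 1 1) * h1

theorem isBoundedAtImInfty_twist {a b c d : ℤ} (hdet : a * d - b * c = 1) :
    UpperHalfPlane.IsBoundedAtImInfty fun τ : ℍ => D.twist a b τ := by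
  choose k hk hlim using fun i => exists_tendsto_norm_klein (D.not_int hdet i)
  have hT : Tendsto (fun τ : ℍ => ∏ i, (‖klein (D.t i * a / N) (D.t i * b / N) τ‖ *
      Real.exp (-(π * τ.im * fractBump (D.t i * a / N)))) ^ (2 * D.e i))
      UpperHalfPlane.atImInfty (𝓝 (∏ i, k i ^ (2 * D.e i))) :=
    tendsto_finsetProd _ fun i _ => (hlim i).zpow₀ _ (Or.inl (hk i).ne')
  refine Asymptotics.IsBigO.trans ?_ (hT.isBigO_one ℝ)
  refine Asymptotics.IsBigO.of_bound 1 (Eventually.of_forall fun τ => ?_)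
  rw [one_mul, twist, norm_prod, Real.norm_of_nonneg]
  · simp_rw [norm_zpow, mul_zpow]
    rw [Finset.prod_mul_distrib]
    -- The normalising exponentials multiply to at least `1`, by `nonpos`; dropping them only
    -- decreases the convergent product.
    refine le_mul_of_one_le_right (Finset.prod_nonneg fun i _ => by positivity) ?_
    have : ∀ i, Real.exp (-(π * τ.im * fractBump (D.t i * a / N))) ^ (2 * D.e i) =
        Real.exp (-(2 * π * τ.im * (D.e i * fractBump (D.t i * a / N)))) := by
      intro i
      rw [← Real.rpow_intCast, ← Real.exp_mul]
      push_cast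
      ring_nf
    rw [Finset.prod_congr rfl fun i _ => this i, ← Real.exp_sum, Real.one_le_exp_iff,
      Finset.sum_neg_distrib, ← Finset.mul_sum]
    have h1 := D.nonpos a
    have h2 := UpperHalfPlane.im_pos τ
    have h3 := Real.pi_pos
    have h4 : 0 < 2 * π * τ.im := by positivity
    nlinarith
  · exact Finset.prod_nonneg fun i _ => by positivity

theorem isBoundedAtImInfty_form_slash (γ : SL(2, ℤ)) :
    UpperHalfPlane.IsBoundedAtImInfty (D.form ∣[(2 : ℤ)] γ) := by
  obtain ⟨a, b, c, d, A, B, g, hdet, hA, hg, h00, h01, h10, h11⟩ :=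
    exists_decomposition (Int.natCast_pos.2 D.N_pos) γ
  obtain ⟨M, R, hM⟩ :=
    UpperHalfPlane.isBoundedAtImInfty_iff.1 (D.isBoundedAtImInfty_twist hdet)
  rw [UpperHalfPlane.isBoundedAtImInfty_iff]
  have hgR : (0 : ℝ) < g := Int.cast_pos.2 hg
  have hAR : (0 : ℝ) < A := Int.cast_pos.2 hA
  refine ⟨‖(g : ℂ) ^ (-2 : ℤ)‖ * M, R * g / A, fun τ hτ => ?_⟩
  rw [D.form_slash γ hdet hA hg h00 h01 h10 h11, norm_mul]
  have him : ((A * τ + B) / g : ℂ).im = A * τ.im / g := by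
    have : ((A * τ + B) / g : ℂ) = (A / g : ℝ) * τ + (B / g : ℝ) := by push_cast; ring
    rw [this]
    simp
    ring
  have hpos : 0 < ((A * τ + B) / g : ℂ).im := by
    have := UpperHalfPlane.im_pos τ
    rw [him]
    positivity
  refine mul_le_mul_of_nonneg_left (hM ⟨_, hpos⟩ ?_) (norm_nonneg _)
  change R ≤ ((A * τ + B) / g : ℂ).im
  rw [him, le_div_iff₀ hgR]
  rw [div_le_iff₀ hAR] at hτ
  linarith

end KleinDatum

/-! ### Taylor coefficients in a subring and q-expansions -/

section TaylorSeries

open Filter Topology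

/-- The Taylor series of a function at the origin. -/
noncomputable def taylorSeries (F : ℂ → ℂ) : PowerSeries ℂ :=
  .mk fun m => (m.factorial : ℂ)⁻¹ * iteratedDeriv m F 0

theorem coeff_taylorSeries (F : ℂ → ℂ) (m : ℕ) :
    (taylorSeries F).coeff m = (m.factorial : ℂ)⁻¹ * iteratedDeriv m F 0 :=
  PowerSeries.coeff_mk ..

theorem constantCoeff_taylorSeries (F : ℂ → ℂ) :
    PowerSeries.constantCoeff (taylorSeries F) = F 0 := by
  rw [← PowerSeries.coeff_zero_eq_constantCoeff_apply, coeff_taylorSeries]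
  simp

theorem taylorSeries_mul {F G : ℂ → ℂ} (hF : AnalyticAt ℂ F 0) (hG : AnalyticAt ℂ G 0) :
    taylorSeries (F * G) = taylorSeries F * taylorSeries G := by
  ext m
  simp only [coeff_taylorSeries, iteratedDeriv_mul hF.contDiffAt hG.contDiffAt, Finset.mul_sum,
    PowerSeries.coeff_mul, Finset.Nat.sum_antidiagonal_eq_sum_range_succ_mk, Nat.succ_eq_add_one]
  refine Finset.sum_congr rfl fun i hi => ?_
  rw [Nat.cast_choose _ (by grind)]
  field_simp [Nat.factorial_ne_zero]

theorem taylorSeries_sub {F G : ℂ → ℂ} (hF : AnalyticAt ℂ F 0) (hG : AnalyticAt ℂ G 0) :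
    taylorSeries (F - G) = taylorSeries F - taylorSeries G := by
  ext m
  simp only [coeff_taylorSeries, iteratedDeriv_sub hF.contDiffAt hG.contDiffAt, map_sub, mul_sub]

theorem taylorSeries_const (c : ℂ) : taylorSeries (fun _ => c) = PowerSeries.C c := by
  ext m
  rw [coeff_taylorSeries, PowerSeries.coeff_C, iteratedDeriv_const]
  split_ifs with h <;> simp [h]

theorem taylorSeries_id : taylorSeries (fun q => q) = PowerSeries.X := by
  ext m
  rw [coeff_taylorSeries, PowerSeries.coeff_X]
  rcases m with _ | m
  · simp
  · rw [iteratedDeriv_succ', show deriv (fun q : ℂ => q) = fun _ => 1 from deriv_id',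
      iteratedDeriv_const]
    rcases m with _ | m <;> simp

theorem taylorSeries_pow (k : ℕ) :
    taylorSeries (fun q => q ^ k) = PowerSeries.X ^ k := by
  induction k with
  | zero => simpa using taylorSeries_const 1
  | succ k ih =>
    have h1 : AnalyticAt ℂ (fun q : ℂ => q ^ k) 0 := by fun_prop
    have h2 : AnalyticAt ℂ (fun q : ℂ => q) 0 := by fun_prop
    have := taylorSeries_mul h1 h2
    rw [ih, taylorSeries_id, ← pow_succ] at this
    rw [← this]
    rfl

theorem taylorSeries_congr {F G : ℂ → ℂ} (h : F =ᶠ[𝓝 0] G) : taylorSeries F = taylorSeries G := by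
  ext m
  rw [coeff_taylorSeries, coeff_taylorSeries, h.iteratedDeriv_eq]

theorem tendstoLocallyUniformlyOn_iteratedDeriv {ι : Type*} {l : Filter ι} {U : Set ℂ}
    (hU : IsOpen U) (m : ℕ) {F : ι → ℂ → ℂ} {f : ℂ → ℂ} (hf : TendstoLocallyUniformlyOn F f l U)
    (hF : ∀ i, DifferentiableOn ℂ (F i) U) :
    TendstoLocallyUniformlyOn (fun i => iteratedDeriv m (F i)) (iteratedDeriv m f) l U := by
  induction m generalizing F f with
  | zero => simpa using hf
  | succ m ih =>
    simp_rw [iteratedDeriv_succ']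
    exact ih (hf.deriv (Eventually.of_forall hF) hU) fun i => (hF i).deriv hU

/-- The function is analytic at the origin and its Taylor coefficients lie in `A`. -/
def HasTaylorIn (A : Subring ℂ) (F : ℂ → ℂ) : Prop :=
  AnalyticAt ℂ F 0 ∧ ∀ m, (taylorSeries F).coeff m ∈ A

namespace HasTaylorIn

variable {A : Subring ℂ} {F G : ℂ → ℂ}

theorem const {c : ℂ} (hc : c ∈ A) : HasTaylorIn A fun _ => c := by
  refine ⟨analyticAt_const, fun m => ?_⟩
  rw [taylorSeries_const, PowerSeries.coeff_C]
  split_ifs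
  exacts [hc, A.zero_mem]

theorem pow_id (k : ℕ) : HasTaylorIn A fun q => q ^ k := by
  refine ⟨by fun_prop, fun m => ?_⟩
  rw [taylorSeries_pow, PowerSeries.coeff_X_pow]
  split_ifs
  exacts [A.one_mem, A.zero_mem]

theorem mul (hF : HasTaylorIn A F) (hG : HasTaylorIn A G) :
    HasTaylorIn A fun q => F q * G q := by
  refine ⟨hF.1.fun_mul hG.1, fun m => ?_⟩
  have := taylorSeries_mul hF.1 hG.1
  change (taylorSeries (F * G)).coeff m ∈ A
  rw [this, PowerSeries.coeff_mul]
  exact A.sum_mem fun i _ => A.mul_mem (hF.2 _) (hG.2 _)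

theorem sub (hF : HasTaylorIn A F) (hG : HasTaylorIn A G) :
    HasTaylorIn A fun q => F q - G q := by
  refine ⟨hF.1.fun_sub hG.1, fun m => ?_⟩
  change (taylorSeries (F - G)).coeff m ∈ A
  rw [taylorSeries_sub hF.1 hG.1, map_sub]
  exact A.sub_mem (hF.2 _) (hG.2 _)

theorem pow (hF : HasTaylorIn A F) (n : ℕ) : HasTaylorIn A fun q => F q ^ n := by
  induction n with
  | zero => simpa using const A.one_mem
  | succ n ih =>
    simp_rw [pow_succ]
    exact ih.mul hF

theorem finset_prod {ι : Type*} (s : Finset ι) {F : ι → ℂ → ℂ} (hF : ∀ i, HasTaylorIn A (F i)) :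
    HasTaylorIn A fun q => ∏ i ∈ s, F i q := by
  classical
  induction s using Finset.induction_on with
  | empty => simpa using const A.one_mem
  | insert i s hi ih =>
    simp_rw [Finset.prod_insert hi]
    exact (hF i).mul ih

/-- With constant term `1`, the coefficients of the inverse obey a recursion without denominators.
-/
theorem inv (hF : HasTaylorIn A F) (h0 : F 0 = 1) : HasTaylorIn A fun q => (F q)⁻¹ := by
  have hne : F 0 ≠ 0 := by simp [h0]
  have hFi : AnalyticAt ℂ (fun q => (F q)⁻¹) 0 := hF.1.fun_inv hne
  refine ⟨hFi, fun m => ?_⟩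
  have hmul : taylorSeries F * taylorSeries (fun q => (F q)⁻¹) = 1 := by
    rw [← taylorSeries_mul hF.1 hFi, ← map_one PowerSeries.C, ← taylorSeries_const]
    refine taylorSeries_congr ?_
    filter_upwards [hF.1.continuousAt.eventually_ne hne] with q hq
    exact mul_inv_cancel₀ hq
  induction m using Nat.strong_induction_on with
  | _ m ih =>
    have h1 := congrArg (PowerSeries.coeff m) hmul
    rw [PowerSeries.coeff_mul, Finset.Nat.sum_antidiagonal_eq_sum_range_succ_mk,
      Finset.sum_range_succ', PowerSeries.coeff_zero_eq_constantCoeff_apply,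
      constantCoeff_taylorSeries, h0, one_mul, Nat.sub_zero] at h1
    rw [eq_sub_of_add_eq' h1]
    refine A.sub_mem ?_ (A.sum_mem fun k hk => A.mul_mem (hF.2 _) (ih _ ?_))
    · rw [PowerSeries.coeff_one]
      split_ifs
      exacts [A.one_mem, A.zero_mem]
    · have := Finset.mem_range.1 hk
      omega

theorem zpow (hF : HasTaylorIn A F) (h0 : F 0 = 1) (n : ℤ) : HasTaylorIn A fun q => F q ^ n := by
  rcases n with n | n
  · simpa using hF.pow n
  · simp_rw [zpow_negSucc]
    exact (hF.pow (n + 1)).inv (by simp [h0])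

end HasTaylorIn

/-- The infinite product `∏ (1 - a_n q ^ {e_n})`. -/
noncomputable def eulerProd (a : ℕ → ℂ) (e : ℕ → ℕ) (q : ℂ) : ℂ := ∏' n, (1 - a n * q ^ e n)

theorem eulerProd_zero {a : ℕ → ℂ} {e : ℕ → ℕ} (he : ∀ n, n < e n) : eulerProd a e 0 = 1 := by
  have : ∀ n, e n ≠ 0 := fun n => (Nat.zero_lt_of_lt (he n)).ne'
  simp [eulerProd, this]

/-- By `n < e n`, the `m`-th coefficient of the partial products is constant from index `m` on.
Locally uniform convergence carries over to derivatives, so this is also the coefficient of the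
limit. -/
theorem hasTaylorIn_eulerProd {A : Subring ℂ} {a : ℕ → ℂ} {e : ℕ → ℕ} (ha : ∀ n, ‖a n‖ ≤ 1)
    (haA : ∀ n, a n ∈ A) (he : ∀ n, n < e n) : HasTaylorIn A (eulerProd a e) := by
  set U : Set ℂ := Metric.ball 0 1
  have hU : IsOpen U := Metric.isOpen_ball
  have h0 : (0 : ℂ) ∈ U := Metric.mem_ball_self one_pos
  have hd : ∀ n, DifferentiableOn ℂ (fun q : ℂ => a n * q ^ e n) U := fun n => by fun_prop
  have hb : ∀ K ⊆ U, IsCompact K → ∃ u : ℕ → ℝ, Summable u ∧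
      ∀ n, ∀ z ∈ K, ‖a n * z ^ e n‖ ≤ u n := by
    intro K hKU hK
    rcases K.eq_empty_or_nonempty with rfl | hne
    · exact ⟨0, summable_zero, by simp⟩
    obtain ⟨z₁, hz₁, h₁⟩ := hK.exists_isMaxOn hne continuousOn_id.norm
    have hlt : ‖z₁‖ < 1 := by simpa [U] using hKU hz₁
    refine ⟨fun n => ‖z₁‖ ^ n, summable_geometric_of_lt_one (norm_nonneg _) hlt, fun n z hz => ?_⟩
    have b : ‖z‖ ≤ ‖z₁‖ := h₁ hz
    rw [norm_mul, norm_pow]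
    calc ‖a n‖ * ‖z‖ ^ e n ≤ 1 * ‖z₁‖ ^ e n := by gcongr; exact ha n
      _ ≤ ‖z₁‖ ^ n := by
        rw [one_mul]
        exact pow_le_pow_of_le_one (norm_nonneg _) hlt.le (he n).le
  have hT := tendstoLocallyUniformlyOn_tprod_one_sub hU hd hb
  have hD := differentiableOn_finset_prod_one_sub hd
  have hfactor : ∀ n, HasTaylorIn A fun q => 1 - a n * q ^ e n := fun n =>
    (HasTaylorIn.const A.one_mem).sub ((HasTaylorIn.const (haA n)).mul (HasTaylorIn.pow_id _))
  set P : ℕ → ℂ → ℂ := fun M q => ∏ n ∈ Finset.range M, (1 - a n * q ^ e n) with hP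
  have hPA : ∀ M, HasTaylorIn A (P M) := fun M => HasTaylorIn.finset_prod _ hfactor
  refine ⟨(differentiableOn_tprod_one_sub hU hd hb).analyticAt (hU.mem_nhds h0), fun m => ?_⟩
  have hstep : ∀ M, m ≤ M → (taylorSeries (P (M + 1))).coeff m = (taylorSeries (P M)).coeff m := by
    intro M hM
    have e1 : P (M + 1) = P M - P M * ((fun _ => a M) * fun q => q ^ e M) := by
      funext q
      simp only [hP, Finset.prod_range_succ, Pi.sub_apply, Pi.mul_apply]
      ring
    have h1 : AnalyticAt ℂ (fun _ : ℂ => a M) 0 := analyticAt_const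
    have h2 : AnalyticAt ℂ (fun q : ℂ => q ^ e M) 0 := by fun_prop
    rw [e1, taylorSeries_sub (hPA M).1 ((hPA M).1.mul (h1.mul h2)),
      taylorSeries_mul (hPA M).1 (h1.mul h2), taylorSeries_mul h1 h2, taylorSeries_pow, ← mul_assoc,
      map_sub, PowerSeries.coeff_mul_X_pow', if_neg (by have := he M; omega), sub_zero]
  have hconst : ∀ M, m ≤ M → (taylorSeries (P M)).coeff m = (taylorSeries (P m)).coeff m := by
    intro M hM
    induction M, hM using Nat.le_induction with
    | base => rfl
    | succ M hM ih => rw [hstep M hM, ih]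
  have hlim : Tendsto (fun M => (taylorSeries (P M)).coeff m) atTop
      (𝓝 ((taylorSeries (eulerProd a e)).coeff m)) := by
    simp_rw [coeff_taylorSeries]
    exact ((tendstoLocallyUniformlyOn_iteratedDeriv hU m hT hD).tendsto_at h0).const_mul _
  have := tendsto_nhds_unique hlim (tendsto_const_nhds.congr' (by
    filter_upwards [eventually_ge_atTop m] with M hM using (hconst M hM).symm))
  rw [this]
  exact (hPA m).2 m

theorem qExpansion_eq_taylorSeries {h : ℝ} (hh : 0 < h) {f : ℍ → ℂ} {Φ : ℂ → ℂ}
    (hΦ : AnalyticAt ℂ Φ 0) (hf : ∀ τ : ℍ, f τ = Φ (Function.Periodic.qParam h τ)) :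
    UpperHalfPlane.qExpansion h f = taylorSeries Φ := by
  have hne : ∀ q : ℂ, q ≠ 0 → ‖q‖ < 1 → UpperHalfPlane.cuspFunction h f q = Φ q := by
    intro q hq hq1
    have him := Function.Periodic.im_invQParam_pos_of_norm_lt_one hh hq1 hq
    rw [UpperHalfPlane.cuspFunction, Function.Periodic.cuspFunction_eq_of_nonzero h _ hq,
      Function.comp_apply, hf, UpperHalfPlane.ofComplex_apply_of_im_pos him]
    exact congrArg Φ (Function.Periodic.qParam_right_inv hh.ne' hq)
  have hball : ∀ᶠ q in 𝓝 (0 : ℂ), ‖q‖ < 1 := by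
    filter_upwards [Metric.ball_mem_nhds (0 : ℂ) one_pos] with q hq using by simpa using hq
  have hpun : UpperHalfPlane.cuspFunction h f =ᶠ[𝓝[≠] 0] Φ := by
    filter_upwards [self_mem_nhdsWithin, nhdsWithin_le_nhds hball] with q hq hq1 using hne q hq hq1
  -- The cusp function is defined at `0` as a punctured limit, so continuity of `Φ` settles this
  -- point.
  have h0 : UpperHalfPlane.cuspFunction h f 0 = Φ 0 := by
    rw [UpperHalfPlane.cuspFunction, Function.Periodic.cuspFunction_zero_eq_limUnder_nhds_ne]
    exact ((hΦ.continuousAt.tendsto.mono_left nhdsWithin_le_nhds).congr' hpun.symm).limUnder_eq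
  ext m
  rw [UpperHalfPlane.qExpansion_coeff, coeff_taylorSeries]
  congr 1
  refine Filter.EventuallyEq.iteratedDeriv_eq m ?_
  filter_upwards [hball] with q hq1
  rcases eq_or_ne q 0 with rfl | hq
  exacts [h0, hne q hq hq1]

end TaylorSeries

/-! ### Holomorphy and the modular form -/

section Holomorphy

open Filter Topology Complex
open scoped Real

theorem differentiableOn_klein (x y : ℝ) : DifferentiableOn ℂ (klein x y) {τ | 0 < τ.im} := by
  have hU : IsOpen {τ : ℂ | 0 < τ.im} := isOpen_lt continuous_const continuous_im
  have hq : ∀ τ ∈ {τ : ℂ | 0 < τ.im}, ‖e2pi τ‖ < 1 := fun τ hτ => norm_e2pi_lt_one hτ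
  have h1 := differentiableOn_qPoch hU (w := fun τ => e2pi (x * τ + y)) (q := e2pi)
    (by fun_prop) (by fun_prop) hq
  have h2 := differentiableOn_qPoch hU (w := fun τ => e2pi τ * (e2pi (x * τ + y))⁻¹) (q := e2pi)
    (by simp_rw [← e2pi_neg]; fun_prop) (by fun_prop) hq
  have h3 := differentiableOn_qPoch hU (w := e2pi) (q := e2pi) (by fun_prop) (by fun_prop) hq
  have h4 : DifferentiableOn ℂ (fun τ : ℂ => exp (π * I * ((x - 1) * (x * τ + y))))
      {τ | 0 < τ.im} := by fun_prop
  exact h4.fun_mul ((h1.fun_mul h2).fun_div (h3.fun_pow 2) fun τ hτ =>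
    pow_ne_zero 2 (qPoch_ne_zero (hq τ hτ) (hq τ hτ)))

namespace KleinDatum

variable {N : ℕ} (D : KleinDatum N)

theorem differentiableOn_twist {a b c d : ℤ} (hdet : a * d - b * c = 1) :
    DifferentiableOn ℂ (D.twist a b) {τ | 0 < τ.im} := by
  have := DifferentiableOn.finsetProd (𝕜 := ℂ) (u := Finset.univ) (s := {τ : ℂ | 0 < τ.im})
    (f := fun i τ => klein (D.t i * a / N) (D.t i * b / N) τ ^ (2 * D.e i)) fun i _ =>
      (differentiableOn_klein _ _).zpow (Or.inl fun τ hτ => klein_ne_zero hτ (D.not_int hdet i))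
  refine this.congr fun τ _ => ?_
  simp [twist]

theorem mdifferentiable_form : MDifferentiable (modelWithCornersSelf ℂ ℂ)
    (modelWithCornersSelf ℂ ℂ) D.form := by
  rw [UpperHalfPlane.mdifferentiable_iff]
  have hN : (0 : ℝ) < N := Nat.cast_pos.2 D.N_pos
  have h := (D.differentiableOn_twist (a := 1) (b := 0) (c := 0) (d := 1) (by norm_num)).comp
    (show DifferentiableOn ℂ (fun z : ℂ => N * z) {z | 0 < z.im} by fun_prop) (fun z hz => by
      have hz : 0 < z.im := hz
      show 0 < (N * z : ℂ).im
      simp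
      positivity)
  refine h.congr fun z hz => ?_
  rw [Function.comp_apply, UpperHalfPlane.ofComplex_apply_of_im_pos hz]
  rfl

/-- The product of Klein forms as a modular form of weight two for `Γ₁(N)`. -/
noncomputable def modularForm :
    ModularForm ((CongruenceSubgroup.Gamma1 N : Subgroup SL(2, ℤ)) : Subgroup (GL (Fin 2) ℝ)) 2 where
  toFun := D.form
  slash_action_eq' := by
    rintro _ ⟨γ, hγ, rfl⟩
    exact D.form_slash_of_mem_Gamma1 hγ
  holo' := D.mdifferentiable_form
  bdd_at_cusps' := by
    intro c hc
    have : NeZero N := ⟨D.N_pos.ne'⟩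
    rw [Subgroup.IsArithmetic.isCusp_iff_isCusp_SL2Z] at hc
    rw [OnePoint.isBoundedAt_iff_forall_SL2Z hc]
    exact fun γ _ => D.isBoundedAtImInfty_form_slash γ

end KleinDatum

end Holomorphy

/-! ### Comparison with the Klein form of the statement -/

section KleinFormComparison

open Filter Topology Complex
open scoped Real

theorem kleinForm_eq_klein (r₁ r₂ : ℚ) {τ : ℂ} (hτ : 0 < τ.im) :
    kleinForm r₁ r₂ τ = klein r₁ r₂ τ := by
  have hq := norm_e2pi_lt_one hτ
  set q := e2pi τ with hqdef
  set w := e2pi (r₁ * τ + r₂) with hw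
  have hm : ∀ v, HasProd (fun n : ℕ => 1 - q ^ (n + 1) * v) (qPoch (q * v) q) := by
    intro v
    convert (multipliable_qPoch hq (q * v)).hasProd using 2 with n
    · ring
    · rfl
  have h1 : HasProd (fun n : ℕ => 1 - q ^ (n + 1)) (qPoch q q) := by
    simpa using hm 1
  have h2 : HasProd (fun n : ℕ => ((1 - q ^ (n + 1)) ^ 2)⁻¹) ((qPoch q q ^ 2)⁻¹) := by
    have := (h1.mul h1).inv₀ (mul_ne_zero (qPoch_ne_zero hq hq) (qPoch_ne_zero hq hq))
    simpa [sq] using this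
  have key := (((hm w).mul (hm w⁻¹)).mul h2).tprod_eq
  rw [kleinForm]
  change _ * _ * (1 - w) * ∏' n : ℕ, ((1 - q ^ (n + 1) * w) * (1 - q ^ (n + 1) * w⁻¹) *
    ((1 - q ^ (n + 1)) ^ 2)⁻¹) = _
  rw [key, klein, thetaQ]
  have hw' : e2pi (((r₁ : ℝ) : ℂ) * τ + ((r₂ : ℝ) : ℂ)) = w := by simp [hw]
  rw [hw', ← hqdef, qPoch_eq_one_sub_mul hq w, ← exp_add]
  have he : (π * I * (r₂ * (r₁ - 1)) + 2 * π * I * (r₁ * (r₁ - 1) / 2 * τ) : ℂ) =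
      π * I * ((((r₁ : ℝ) : ℂ) - 1) * (((r₁ : ℝ) : ℂ) * τ + ((r₂ : ℝ) : ℂ))) := by
    push_cast
    ring
  rw [he, div_eq_mul_inv]
  ring

end KleinFormComparison

/-! ### Expansions at the cusps infinity and zero -/

namespace KleinDatum

open Filter Topology Complex
open scoped Real

variable {N : ℕ} (D : KleinDatum N)

theorem form_eq_prod_kleinAt (τ : ℍ) : D.form τ = ∏ i, kleinAt N (D.t i) τ ^ (2 * D.e i) := by
  have hN : (0 : ℝ) < N := Nat.cast_pos.2 D.N_pos
  have him : 0 < (N * τ : ℂ).im := by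
    have := UpperHalfPlane.im_pos τ
    simp
    positivity
  rw [form, twist]
  refine Finset.prod_congr rfl fun i _ => ?_
  rw [kleinAt, kleinForm_eq_klein _ _ him]
  simp

/-- The `q`-expansion at `∞` has integral coefficients. -/
theorem exists_qExpansion_eq_map_int : ∃ a : PowerSeries ℤ,
    UpperHalfPlane.qExpansion 1 D.form = a.map (Int.castRingHom ℂ) := by
  have hN : (N : ℂ) ≠ 0 := Nat.cast_ne_zero.2 D.N_pos.ne'
  have hNR : (0 : ℝ) < N := Nat.cast_pos.2 D.N_pos
  have hN1 : 1 ≤ N := D.N_pos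
  set A : Subring ℂ := (Int.castRingHom ℂ).range
  obtain ⟨m, hm⟩ := D.dvd
  -- The leading power of `q` is `∑ e t (t/N - 1)`, which is this `k`: an integer by `dvd`, and
  -- nonnegative by `nonpos` at `a = 1`.
  obtain ⟨k, hk⟩ : ∃ k : ℕ, (k : ℤ) = m - ∑ i, D.e i * D.t i := by
    refine ⟨(m - ∑ i, D.e i * D.t i).toNat, Int.toNat_of_nonneg ?_⟩
    have h := D.nonpos 1
    have hb : ∀ i, fractBump (D.t i * (1 : ℤ) / N) = D.t i / N * (1 - D.t i / N) := by
      intro i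
      have : Int.fract (D.t i * (1 : ℤ) / N : ℝ) = D.t i / N := by
        rw [Int.cast_one, mul_one, Int.fract_eq_self]
        exact ⟨by positivity, (div_lt_one hNR).2 (Nat.cast_lt.2 (D.lt i))⟩
      rw [fractBump, this]
    simp_rw [hb] at h
    have hmR : (∑ i, (D.e i : ℝ) * (D.t i : ℝ) ^ 2) = N * m := by exact_mod_cast hm
    have : ((m - ∑ i, D.e i * D.t i : ℤ) : ℝ) =
        N * -(∑ i, (D.e i : ℝ) * (D.t i / N * (1 - D.t i / N))) := by
      have e1 : (∑ i, (D.e i : ℝ) * (D.t i / N * (1 - D.t i / N))) =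
          (∑ i, (D.e i : ℝ) * D.t i) / N - (∑ i, (D.e i : ℝ) * (D.t i : ℝ) ^ 2) / N ^ 2 := by
        rw [Finset.sum_div, Finset.sum_div, ← Finset.sum_sub_distrib]
        refine Finset.sum_congr rfl fun i _ => ?_
        field_simp
      rw [e1, hmR]
      push_cast
      field_simp
      ring
    have h2 : (0 : ℝ) ≤ ((m - ∑ i, D.e i * D.t i : ℤ) : ℝ) := by
      rw [this]
      nlinarith
    exact_mod_cast h2
  set Ψ : Fin 3 → ℂ → ℂ := fun i q =>
    eulerProd (fun _ => 1) (fun n => D.t i + N * n) q *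
      eulerProd (fun _ => 1) (fun n => (N - D.t i) + N * n) q *
        (eulerProd (fun _ => 1) (fun n => N + N * n) q ^ 2)⁻¹ with hΨ
  have he : ∀ s : ℕ, 0 < s → ∀ n, n < s + N * n := fun s hs n => by
    have := Nat.mul_le_mul_right n hN1
    omega
  have hs : ∀ i, 0 < N - D.t i := fun i => Nat.sub_pos_of_lt (D.lt i)
  have hE : ∀ s : ℕ, 0 < s → HasTaylorIn A (eulerProd (fun _ => 1) fun n => s + N * n) := fun s hs =>
    hasTaylorIn_eulerProd (by simp) (fun _ => A.one_mem) (he s hs)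
  have hΨA : ∀ i, HasTaylorIn A (Ψ i) := fun i =>
    ((hE _ (D.pos i)).mul (hE _ (hs i))).mul
      (((hE _ D.N_pos).pow 2).inv (by rw [eulerProd_zero (he N D.N_pos), one_pow]))
  have hΨ0 : ∀ i, Ψ i 0 = 1 := fun i => by
    simp only [hΨ, eulerProd_zero (he _ (D.pos i)), eulerProd_zero (he _ (hs i)),
      eulerProd_zero (he N D.N_pos)]
    simp
  set Φ : ℂ → ℂ := fun q => q ^ k * ∏ i, Ψ i q ^ (2 * D.e i) with hΦ
  have hΦA : HasTaylorIn A Φ :=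
    (HasTaylorIn.pow_id k).mul (HasTaylorIn.finset_prod _ fun i => (hΨA i).zpow (hΨ0 i) _)
  have hform : ∀ τ : ℍ, D.form τ = Φ (Function.Periodic.qParam (1 : ℝ) τ) := by
    intro τ
    have hq : Function.Periodic.qParam (1 : ℝ) τ = e2pi τ := by
      simp [Function.Periodic.qParam, e2pi]
    set q := e2pi τ with hqd
    have hq0 : q ≠ 0 := e2pi_ne_zero _
    have hqN : e2pi (N * τ) = q ^ N := (e2pi_pow _ _).symm
    have hP : ∀ s : ℕ, qPoch (q ^ s) (q ^ N) = eulerProd (fun _ => 1) (fun n => s + N * n) q := by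
      intro s
      refine tprod_congr fun n => ?_
      rw [one_mul, pow_add, pow_mul]
    have hi : ∀ i, klein (D.t i * (1 : ℤ) / N) (D.t i * (0 : ℤ) / N) (N * τ) ^ (2 * D.e i) =
        e2pi (D.e i * (D.t i * (D.t i / N - 1)) * τ) * Ψ i q ^ (2 * D.e i) := by
      intro i
      have harg : (((D.t i * (1 : ℤ) / N : ℝ) : ℂ) * (N * τ) + ((D.t i * (0 : ℤ) / N : ℝ) : ℂ)) =
          D.t i * τ := by
        push_cast
        field_simp
        ring
      have hsub : q ^ N * (q ^ D.t i)⁻¹ = q ^ (N - D.t i) := by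
        rw [pow_sub₀ _ hq0 (D.lt i).le]
      rw [klein, harg, mul_zpow, thetaQ, hqN, ← e2pi_pow, ← hqd, hsub, hP, hP, hP, ← exp_int_mul]
      congr 1
      rw [e2pi]
      congr 1
      push_cast
      ring
    rw [form, twist, Finset.prod_congr rfl fun i _ => hi i, Finset.prod_mul_distrib, hq]
    simp only [hΦ]
    congr 1
    rw [Fin.prod_univ_three, ← e2pi_add, ← e2pi_add, hqd, e2pi_pow]
    congr 1
    have hmC : (∑ i, (D.e i : ℂ) * (D.t i : ℂ) ^ 2) = N * m := by exact_mod_cast hm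
    have hkC : (k : ℂ) = m - ∑ i, (D.e i : ℂ) * D.t i := by exact_mod_cast hk
    rw [hkC, Fin.sum_univ_three]
    rw [Fin.sum_univ_three] at hmC
    field_simp
    linear_combination τ * hmC
  have hcoeff : ∀ n, ∃ z : ℤ, (Int.castRingHom ℂ) z = (taylorSeries Φ).coeff n := fun n =>
    hΦA.2 n
  choose z hz using hcoeff
  refine ⟨PowerSeries.mk z, ?_⟩
  rw [qExpansion_eq_taylorSeries one_pos hΦA.1 hform]
  ext n
  rw [PowerSeries.coeff_map, PowerSeries.coeff_mk, hz]

/-- The expansion of the form at the cusp `0`: a constant times a power series with constant term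
`1` whose coefficients lie in any given ring containing `ζ_N`. -/
theorem exists_taylor_slash {A : Subring ℂ} (hζ : ∀ s : ℤ, e2pi (s / N) ∈ A) {α : SL(2, ℤ)}
    (hα : α 0 0 = 0) : ∃ Φ : ℂ → ℂ, HasTaylorIn A Φ ∧ Φ 0 = 1 ∧
      ∀ τ : ℍ, (D.form ∣[(2 : ℤ)] α) τ = (N : ℂ) ^ (-2 : ℤ) *
        (∏ i, ((e2pi ((D.t i * α 0 1 : ℤ) / N))⁻¹ *
          (1 - e2pi ((D.t i * α 0 1 : ℤ) / N)) ^ 2) ^ D.e i) *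
        Φ (Function.Periodic.qParam (N : ℝ) τ) := by
  have hNR : (0 : ℝ) < N := Nat.cast_pos.2 D.N_pos
  have hdet := α.det_coe
  rw [Matrix.det_fin_two, hα, zero_mul] at hdet
  set b := α 0 1
  set c := α 1 0
  set d := α 1 1
  have hcc : c * c = 1 := by
    have : IsUnit c := IsUnit.of_mul_eq_one (-b) (by linear_combination hdet)
    rcases Int.isUnit_iff.1 this with h | h <;> rw [h] <;> norm_num
  set u := e2pi ((d * c : ℤ) / N) with hu
  set w : Fin 3 → ℂ := fun i => e2pi ((D.t i * b : ℤ) / N) with hw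
  have hnorm : ∀ s : ℤ, ‖e2pi (s / N)‖ = 1 := by
    intro s
    rw [norm_e2pi, show (s / N : ℂ) = ((s / N : ℝ) : ℂ) by push_cast; rfl, ofReal_im, mul_zero,
      Real.exp_zero]
  have hwi : ∀ i, (w i)⁻¹ = e2pi ((-(D.t i * b) : ℤ) / N) := fun i => by
    rw [hw, ← e2pi_neg]
    congr 1
    push_cast
    ring
  set E : ℂ → ℂ → ℂ := fun v q => eulerProd (fun n => u ^ (n + 1) * v) (fun n => n + 1) q with hEd
  have hE : ∀ s : ℤ, HasTaylorIn A (E (e2pi (s / N))) := fun s =>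
    hasTaylorIn_eulerProd (fun n => by rw [norm_mul, norm_pow, hnorm, hnorm]; simp)
      (fun n => A.mul_mem (A.pow_mem (hζ _) _) (hζ _)) fun n => Nat.lt_succ_self n
  have hE0 : ∀ v, E v 0 = 1 := fun v => eulerProd_zero fun n => Nat.lt_succ_self n
  set Ψ : Fin 3 → ℂ → ℂ := fun i q => E (w i) q * E (w i)⁻¹ q * (E 1 q ^ 2)⁻¹ with hΨ
  have hE1 : HasTaylorIn A (E 1) := by simpa using hE 0
  have hΨA : ∀ i, HasTaylorIn A (Ψ i) := fun i =>
    ((hE _).mul (by rw [hwi]; exact hE _)).mul ((hE1.pow 2).inv (by rw [hE0, one_pow]))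
  have hΨ0 : ∀ i, Ψ i 0 = 1 := fun i => by simp [hΨ, hE0]
  refine ⟨fun q => ∏ i, Ψ i q ^ (2 * D.e i),
    HasTaylorIn.finset_prod _ fun i => (hΨA i).zpow (hΨ0 i) _, by simp [hΨ0], fun τ => ?_⟩
  -- As `c = ±1`, one has `diag(N, 1) α = (0, b; c, 0) (1, dc; 0, N)`. The first coordinates of the
  -- characteristics vanish, so the factor `1 - w` is constant and can be pulled out.
  rw [D.form_slash α (a := 0) (b := b) (c := c) (d := 0) (A := 1) (B := d * c) (g := N)
    (by linear_combination hdet) one_pos (Int.natCast_pos.2 D.N_pos) (by rw [hα]; ring) (by ring)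
    (by ring) (by linear_combination (-d) * hcc), mul_assoc, twist, ← Finset.prod_mul_distrib]
  congr 1
  refine Finset.prod_congr rfl fun i _ => ?_
  set q := Function.Periodic.qParam (N : ℝ) τ with hq
  set τ₁ : ℂ := ((1 : ℤ) * τ + (d * c : ℤ)) / (N : ℤ) with hτ₁
  have hq1 : e2pi τ₁ = u * q := by
    rw [hu, hq, Function.Periodic.qParam, e2pi, e2pi, ← exp_add]
    congr 1
    rw [hτ₁]
    push_cast
    ring
  have hqn : ‖u * q‖ < 1 := by
    rw [norm_mul, hnorm, one_mul]
    exact Function.Periodic.norm_qParam_lt_one hNR (UpperHalfPlane.im_pos τ)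
  have hP : ∀ v, qPoch (u * q * v) (u * q) = E v q := fun v => by
    refine tprod_congr fun n => ?_
    ring
  have hP1 : qPoch (u * q) (u * q) = E 1 q := by rw [← hP, mul_one]
  have harg : ((D.t i * (0 : ℤ) / N : ℝ) : ℂ) * τ₁ + ((D.t i * b / N : ℝ) : ℂ) =
      (D.t i * b : ℤ) / N := by
    push_cast
    ring
  rw [klein, harg, mul_zpow, thetaQ, hq1, qPoch_eq_one_sub_mul hqn, hP, hP, hP1]
  have h1 : exp (π * I * ((((D.t i * (0 : ℤ) / N : ℝ) : ℂ) - 1) * ((D.t i * b : ℤ) / N))) ^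
      (2 * D.e i) = (w i)⁻¹ ^ D.e i := by
    rw [hwi, zpow_mul]
    congr 1
    rw [zpow_ofNat, ← exp_nat_mul, e2pi]
    congr 1
    push_cast
    ring
  rw [h1, mul_zpow, div_eq_mul_inv, mul_assoc (1 - _), mul_assoc (1 - _), mul_zpow,
    zpow_mul (1 - _), zpow_ofNat]
  simp only [hΨ, hw]
  ring

end KleinDatum

/-! ### Valuations of cyclotomic numbers -/

section CyclotomicValuation

variable {K Γ₀ : Type*} [Field K] [LinearOrderedCommGroupWithZero Γ₀] (v : Valuation K Γ₀)

theorem valuation_eq_one_of_pow_eq_one {x : K} {n : ℕ} (hn : n ≠ 0) (hx : x ^ n = 1) :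
    v x = 1 := by
  have h : v x ^ n = 1 := by rw [← map_pow, hx, map_one]
  exact (pow_eq_one_iff_of_nonneg zero_le hn).1 h

theorem valuation_one_sub_pow_le {x : K} (hx : v x ≤ 1) (k : ℕ) : v (1 - x ^ k) ≤ v (1 - x) := by
  rw [← mul_neg_geom_sum, map_mul]
  refine mul_le_of_le_one_right' (v.map_sum_le fun i _ => ?_)
  rw [map_pow]
  exact pow_le_one₀ zero_le hx

theorem IsPrimitiveRoot.valuation_one_sub_eq {x y : K} {n : ℕ} (hn : n ≠ 0)
    (hx : IsPrimitiveRoot x n) (hy : IsPrimitiveRoot y n) : v (1 - x) = v (1 - y) := by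
  have : NeZero n := ⟨hn⟩
  have h : ∀ {x y : K}, IsPrimitiveRoot x n → IsPrimitiveRoot y n → v (1 - x) ≤ v (1 - y) := by
    intro x y hx hy
    obtain ⟨i, -, rfl⟩ := hy.eq_pow_of_pow_eq_one hx.pow_eq_one
    exact valuation_one_sub_pow_le v (valuation_eq_one_of_pow_eq_one v hn hy.pow_eq_one).le i
  exact le_antisymm (h hx hy) (h hy hx)

/-- The prime `p` is `(1 - ζ) ^ φ(p ^ (k + 1))` up to a unit. -/
theorem IsPrimitiveRoot.valuation_prime_eq_pow {p k : ℕ} (hp : p.Prime) {x : K}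
    (hx : IsPrimitiveRoot x (p ^ (k + 1))) : v p = v (1 - x) ^ (p ^ k * (p - 1)) := by
  have : Fact p.Prime := ⟨hp⟩
  have h0 : 0 < p ^ (k + 1) := pow_pos hp.pos _
  -- At `1` the cyclotomic polynomial takes the value `p`, so `p = ∏ (1 - y)` over the primitive
  -- roots; all these factors have equal valuation.
  have h := congrArg (Polynomial.eval 1) (Polynomial.cyclotomic_eq_prod_X_sub_primitiveRoots hx)
  rw [Polynomial.eval_one_cyclotomic_prime_pow, Polynomial.eval_prod] at h
  rw [h, map_prod, Finset.prod_congr rfl fun y hy => ?_, Finset.prod_const,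
    hx.card_primitiveRoots, Nat.totient_prime_pow_succ hp]
  rw [Polynomial.eval_sub, Polynomial.eval_X, Polynomial.eval_C]
  exact ((mem_primitiveRoots h0).1 hy).valuation_one_sub_eq v h0.ne' hx

end CyclotomicValuation

/-! ### The valuation at `1 - ζ` -/

section PiAdicValuation

variable {p r : ℕ} (hp : p.Prime) (hr : 1 ≤ r)

theorem piIdeal_valuation_pi :
    (piIdeal p r hp hr).valuation (cycField (p ^ r))
      (1 - (zetaInt (p ^ r) : cycField (p ^ r))) = WithZero.exp (-1 : ℤ) := by
  have h := (piIdeal p r hp hr).intValuation_singleton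
    (one_sub_zetaInt_prime p r hp hr).ne_zero rfl
  rw [← IsDedekindDomain.HeightOneSpectrum.valuation_of_algebraMap (K := cycField (p ^ r))] at h
  simpa using h

theorem isPrimitiveRoot_zetaInt (n : ℕ) (hn : n ≠ 0) :
    IsPrimitiveRoot (zetaInt n : cycField n) n :=
  IsPrimitiveRoot.of_map_of_injective (f := (cycField n).val) (zetaC_isPrimitiveRoot n hn)
    (cycField n).val.injective

theorem piIdeal_valuation_one_sub {x : cycField (p ^ r)} (hx : IsPrimitiveRoot x (p ^ r)) :
    (piIdeal p r hp hr).valuation (cycField (p ^ r)) (1 - x) = WithZero.exp (-1 : ℤ) := by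
  have hn : p ^ r ≠ 0 := pow_ne_zero _ hp.ne_zero
  rw [hx.valuation_one_sub_eq _ hn (isPrimitiveRoot_zetaInt _ hn), piIdeal_valuation_pi hp hr]

theorem piIdeal_valuation_prime :
    (piIdeal p r hp hr).valuation (cycField (p ^ r)) p =
      WithZero.exp (-(p ^ (r - 1) * (p - 1) : ℕ) : ℤ) := by
  have hn : p ^ r ≠ 0 := pow_ne_zero _ hp.ne_zero
  obtain ⟨k, rfl⟩ : ∃ k, r = k + 1 := ⟨r - 1, by omega⟩
  rw [(isPrimitiveRoot_zetaInt _ hn).valuation_prime_eq_pow _ hp, piIdeal_valuation_pi hp hr,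
    ← WithZero.exp_nsmul]
  simp

/-- Up to units `p` is both `(1 - x)^(p-1)` and `π^(p^(r-1) (p-1))`; the value group allows
cancelling the exponent `p - 1`. -/
theorem piIdeal_valuation_one_sub_of_order_prime {x : cycField (p ^ r)}
    (hx : IsPrimitiveRoot x p) :
    (piIdeal p r hp hr).valuation (cycField (p ^ r)) (1 - x) =
      WithZero.exp (-(p ^ (r - 1) : ℕ) : ℤ) := by
  have h1 := IsPrimitiveRoot.valuation_prime_eq_pow (k := 0) (x := x)
    ((piIdeal p r hp hr).valuation (cycField (p ^ r))) hp (by simpa using hx)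
  rw [piIdeal_valuation_prime hp hr, pow_zero, one_mul] at h1
  have hp1 : p - 1 ≠ 0 := (Nat.sub_pos_of_lt hp.one_lt).ne'
  refine (pow_left_inj₀ zero_le zero_le hp1).1 ?_
  rw [← h1, ← WithZero.exp_nsmul]
  congr 1
  simp
  ring

theorem nuPi_of_ne_zero {x : cycField (p ^ r)} (hx : x ≠ 0) : nuPi p r hp hr x =
    ((-WithZero.log ((piIdeal p r hp hr).valuation (cycField (p ^ r)) x) : ℤ) : WithTop ℤ) := by
  rw [nuPi, if_neg hx]

theorem nuPi_le_nuPi_mul (x : cycField (p ^ r)) (o : 𝓞 (cycField (p ^ r))) :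
    nuPi p r hp hr x ≤ nuPi p r hp hr (x * (o : cycField (p ^ r))) := by
  by_cases h0 : x * (o : cycField (p ^ r)) = 0
  · rw [h0, nuPi, nuPi, if_pos rfl]
    exact le_top
  · have hx := left_ne_zero_of_mul h0
    have ho := right_ne_zero_of_mul h0
    rw [nuPi_of_ne_zero hp hr hx, nuPi_of_ne_zero hp hr h0, map_mul, WithZero.log_mul
      (by simpa using hx) (by simpa using ho), WithTop.coe_le_coe]
    have h1 : (piIdeal p r hp hr).valuation (cycField (p ^ r)) (o : cycField (p ^ r)) ≤ 1 :=
      (piIdeal p r hp hr).valuation_le_one o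
    have h2 : WithZero.log ((piIdeal p r hp hr).valuation (cycField (p ^ r))
        (o : cycField (p ^ r))) ≤ 0 := by
      rw [← WithZero.log_one]
      exact WithZero.log_le_log (by simpa using ho) one_ne_zero |>.2 h1
    linarith

end PiAdicValuation

/-! ### The minimal valuation at the cusp zero -/

namespace KleinDatum

open Complex

variable {p r : ℕ} (hp : p.Prime) (hr : 1 ≤ r) (D : KleinDatum (p ^ r))

/-- The expansion at the cusp `0` has coefficients in the cyclotomic field, and the minimum of
their `π`-adic valuations is attained at the constant term. -/
theorem exists_qExpansion_slash {ν : Fin 3 → ℤ}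
    (hν : ∀ i, ∀ x : cycField (p ^ r), IsPrimitiveRoot x (p ^ r) →
      (piIdeal p r hp hr).valuation (cycField (p ^ r)) (1 - x ^ D.t i) = WithZero.exp (-ν i))
    {α : SL(2, ℤ)} (hα : α 0 0 = 0) :
    ∃ b : PowerSeries (cycField (p ^ r)),
      UpperHalfPlane.qExpansion ((p ^ r : ℕ) : ℝ) (D.form ∣[(2 : ℤ)] α) =
        b.map (algebraMap (cycField (p ^ r)) ℂ) ∧
      IsLeast (Set.range fun n : ℕ => nuPi p r hp hr (PowerSeries.coeff n b))
        ((2 * ∑ i, D.e i * ν i - 2 * (r * (p ^ (r - 1) * (p - 1) : ℕ)) : ℤ) : WithTop ℤ) := by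
  set K := cycField (p ^ r)
  have hn : p ^ r ≠ 0 := D.N_pos.ne'
  set ζ : K := (zetaInt (p ^ r) : K) with hζd
  have hζ : IsPrimitiveRoot ζ (p ^ r) := isPrimitiveRoot_zetaInt _ hn
  have hζC : algebraMap K ℂ ζ = zetaC (p ^ r) := rfl
  -- Taking the ring of integers makes every coefficient `C` times an integral element, so none has
  -- valuation below that of `C`.
  set A : Subring ℂ := ((algebraMap K ℂ).comp (algebraMap (𝓞 K) K)).range with hA
  have hzpow : ∀ s : ℤ, e2pi (s / (p ^ r : ℕ)) = algebraMap K ℂ (ζ ^ s) := by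
    intro s
    rw [map_zpow₀, hζC, zetaC, ← exp_int_mul, e2pi]
    congr 1
    ring
  have hmem : ∀ s : ℤ, e2pi (s / (p ^ r : ℕ)) ∈ A := by
    intro s
    have hint : IsIntegral ℤ (ζ ^ s) := by
      refine IsIntegral.of_pow (Nat.pos_of_ne_zero hn) ?_
      rw [← zpow_natCast, ← zpow_mul, mul_comm, zpow_mul, zpow_natCast, hζ.pow_eq_one, one_zpow]
      exact isIntegral_one
    exact ⟨⟨ζ ^ s, hint⟩, (hzpow s).symm⟩
  obtain ⟨Φ, hΦA, hΦ0, hΦ⟩ := D.exists_taylor_slash hmem hα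
  have hdet := α.det_coe
  rw [Matrix.det_fin_two, hα, zero_mul] at hdet
  set b := α 0 1
  have hη : IsPrimitiveRoot (ζ ^ b) (p ^ r) := by
    have : IsUnit b := IsUnit.of_mul_eq_one (-α 1 0) (by linear_combination hdet)
    refine hζ.zpow_of_gcd_eq_one b ?_
    rcases Int.isUnit_iff.1 this with h | h <;> rw [h] <;> simp
  set C : K := ((p ^ r : ℕ) : K) ^ (-2 : ℤ) *
    ∏ i, (((ζ ^ b) ^ D.t i)⁻¹ * (1 - (ζ ^ b) ^ D.t i) ^ 2) ^ D.e i with hC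
  have hCC : algebraMap K ℂ C = ((p ^ r : ℕ) : ℂ) ^ (-2 : ℤ) *
        (∏ i, ((e2pi ((D.t i * b : ℤ) / (p ^ r : ℕ)))⁻¹ *
          (1 - e2pi ((D.t i * b : ℤ) / (p ^ r : ℕ))) ^ 2) ^ D.e i) := by
    rw [hC, map_mul, map_zpow₀, map_natCast, map_prod]
    congr 1
    refine Finset.prod_congr rfl fun i _ => ?_
    rw [hzpow, mul_comm (D.t i : ℤ), zpow_mul, zpow_natCast]
    simp only [map_zpow₀, map_mul, map_inv₀, map_pow, map_sub, map_one]
  choose o ho using fun n => hΦA.2 n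
  have ho0 : o 0 = 1 := by
    have h := ho 0
    rw [PowerSeries.coeff_zero_eq_constantCoeff_apply, constantCoeff_taylorSeries, hΦ0] at h
    exact ((algebraMap K ℂ).injective.comp (IsFractionRing.injective (𝓞 K) K))
      (h.trans (map_one ((algebraMap K ℂ).comp (algebraMap (𝓞 K) K))).symm)
  have hwne : ∀ i, 1 - (ζ ^ b) ^ D.t i ≠ 0 := by
    intro i h
    have := hν i _ hη
    rw [h, map_zero] at this
    exact WithZero.exp_ne_zero this.symm
  have hηne : ζ ^ b ≠ 0 := hη.ne_zero hn
  have hCne : C ≠ 0 := by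
    refine mul_ne_zero (zpow_ne_zero _ (Nat.cast_ne_zero.2 hn)) (Finset.prod_ne_zero_iff.2
      fun i _ => zpow_ne_zero _ (mul_ne_zero (inv_ne_zero (pow_ne_zero _ hηne))
        (pow_ne_zero _ (hwne i))))
  have hval : nuPi p r hp hr C =
      ((2 * ∑ i, D.e i * ν i - 2 * (r * (p ^ (r - 1) * (p - 1) : ℕ)) : ℤ) : WithTop ℤ) := by
    rw [nuPi_of_ne_zero hp hr hCne, WithTop.coe_inj]
    have hη1 : (piIdeal p r hp hr).valuation K (ζ ^ b) = 1 :=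
      valuation_eq_one_of_pow_eq_one _ hn hη.pow_eq_one
    have : (piIdeal p r hp hr).valuation K C = WithZero.exp
        (-(2 * ∑ i, D.e i * ν i - 2 * (r * (p ^ (r - 1) * (p - 1) : ℕ)) : ℤ)) := by
      rw [hC, map_mul, map_zpow₀, map_prod, Nat.cast_pow, map_pow, piIdeal_valuation_prime hp hr]
      have : ∀ i, (piIdeal p r hp hr).valuation K
          ((((ζ ^ b) ^ D.t i)⁻¹ * (1 - (ζ ^ b) ^ D.t i) ^ 2) ^ D.e i) =
          WithZero.exp (-(2 * (D.e i * ν i))) := by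
        intro i
        rw [map_zpow₀, map_mul, map_inv₀, map_pow, hη1, map_pow, hν i _ hη, one_pow, inv_one,
          one_mul, ← WithZero.exp_nsmul, ← WithZero.exp_zsmul]
        congr 1
        simp
        ring
      rw [Finset.prod_congr rfl fun i _ => this i, Fin.prod_univ_three, Fin.sum_univ_three,
        ← WithZero.exp_nsmul, ← WithZero.exp_zsmul, ← WithZero.exp_add, ← WithZero.exp_add,
        ← WithZero.exp_add]
      congr 1
      simp
      ring
    rw [this, WithZero.log_exp, neg_neg]
  refine ⟨PowerSeries.mk fun n => C * (o n : K), ?_, ?_⟩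
  · have hcA : AnalyticAt ℂ (fun _ : ℂ => algebraMap K ℂ C) 0 := analyticAt_const
    have hNpos : (0 : ℝ) < ((p ^ r : ℕ) : ℝ) := Nat.cast_pos.2 D.N_pos
    rw [qExpansion_eq_taylorSeries hNpos (Φ := (fun _ => algebraMap K ℂ C) * Φ) (hcA.mul hΦA.1)
      (fun τ => by rw [hΦ, ← hCC]; rfl), taylorSeries_mul hcA hΦA.1, taylorSeries_const]
    ext n
    rw [PowerSeries.coeff_C_mul, PowerSeries.coeff_map, PowerSeries.coeff_mk, map_mul, ← ho]
    rfl
  · rw [← hval]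
    refine ⟨⟨0, ?_⟩, ?_⟩
    · simp [ho0]
    · rintro _ ⟨n, rfl⟩
      simp only [PowerSeries.coeff_mk]
      exact nuPi_le_nuPi_mul hp hr C (o n)

end KleinDatum

/-! ### Inequalities for `{x}(1 - {x})` -/

section FractBump

theorem fractBump_nonneg (x : ℝ) : 0 ≤ fractBump x :=
  mul_nonneg (Int.fract_nonneg x) (sub_nonneg.2 (Int.fract_lt_one x).le)

theorem fractBump_add_intCast (x : ℝ) (n : ℤ) : fractBump (x + n) = fractBump x := by
  rw [fractBump, fractBump, Int.fract_add_intCast]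

theorem fractBump_eq_of_floor {x : ℝ} {n : ℤ} (h : ⌊x⌋ = n) :
    fractBump x = (x - n) * (1 - (x - n)) := by
  rw [fractBump, Int.fract, h]

theorem fractBump_neg (x : ℝ) : fractBump (-x) = fractBump x := by
  by_cases h : Int.fract x = 0
  · have h2 : Int.fract (-x) = 0 := Int.fract_neg_eq_zero.2 h
    rw [fractBump, fractBump, h, h2]
  · rw [fractBump, fractBump, Int.fract_neg h]
    ring

theorem fractBump_nat_mul_fract (k : ℕ) (x : ℝ) :
    fractBump (k * Int.fract x) = fractBump (k * x) := by
  have : (k * x : ℝ) = k * Int.fract x + (k * ⌊x⌋ : ℤ) := by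
    push_cast
    rw [← mul_add, Int.fract_add_floor]
  rw [this, fractBump_add_intCast]

theorem fractBump_five_le (x : ℝ) :
    fractBump (5 * x) ≤ fractBump (3 * x) + fractBump (4 * x) := by
  have h3 := fractBump_nat_mul_fract 3 x
  have h4 := fractBump_nat_mul_fract 4 x
  have h5 := fractBump_nat_mul_fract 5 x
  push_cast at h3 h4 h5
  rw [← h3, ← h4, ← h5]
  set y := Int.fract x
  have hy0 : 0 ≤ y := Int.fract_nonneg x
  have hy1 : y < 1 := Int.fract_lt_one x
  obtain ⟨n, hn⟩ : ∃ n, ⌊3 * y⌋ = n := ⟨_, rfl⟩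
  obtain ⟨m, hm⟩ : ∃ m, ⌊4 * y⌋ = m := ⟨_, rfl⟩
  obtain ⟨k, hk⟩ : ∃ k, ⌊5 * y⌋ = k := ⟨_, rfl⟩
  rw [fractBump_eq_of_floor hn, fractBump_eq_of_floor hm, fractBump_eq_of_floor hk]
  have hn0 : 0 ≤ n := hn ▸ Int.floor_nonneg.2 (by linarith)
  have hm0 : 0 ≤ m := hm ▸ Int.floor_nonneg.2 (by linarith)
  have hk0 : 0 ≤ k := hk ▸ Int.floor_nonneg.2 (by linarith)
  have hn1 : n < 3 := hn ▸ Int.floor_lt.2 (by push_cast; linarith)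
  have hm1 : m < 4 := hm ▸ Int.floor_lt.2 (by push_cast; linarith)
  have hk1 : k < 5 := hk ▸ Int.floor_lt.2 (by push_cast; linarith)
  rw [Int.floor_eq_iff] at hn hm hk
  obtain ⟨hn2, hn3⟩ := hn
  obtain ⟨hm2, hm3⟩ := hm
  obtain ⟨hk2, hk3⟩ := hk
  -- Once the floors are fixed, the quadratic terms cancel because `3² + 4² = 5²`, which leaves
  -- linear inequalities in `y`.
  interval_cases n <;> interval_cases m <;> interval_cases k <;> push_cast at * <;> linarith

theorem fractBump_fifths (a : ℤ) :
    2 * fractBump (a / 5) ≤ fractBump (2 * a / 5) + 2 * fractBump (3 * a / 5) := by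
  obtain ⟨j, i, hi0, hi5, rfl⟩ : ∃ j i : ℤ, 0 ≤ i ∧ i < 5 ∧ a = i + 5 * j :=
    ⟨a / 5, a % 5, Int.emod_nonneg _ (by norm_num), Int.emod_lt_of_pos _ (by norm_num),
      (Int.emod_add_mul_ediv a 5).symm⟩
  have e1 : (((i + 5 * j : ℤ) : ℝ) / 5) = i / 5 + (j : ℤ) := by push_cast; ring
  have e2 : (2 * ((i + 5 * j : ℤ) : ℝ) / 5) = 2 * i / 5 + (2 * j : ℤ) := by push_cast; ring
  have e3 : (3 * ((i + 5 * j : ℤ) : ℝ) / 5) = 3 * i / 5 + (3 * j : ℤ) := by push_cast; ring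
  rw [e1, e2, e3, fractBump_add_intCast, fractBump_add_intCast, fractBump_add_intCast]
  have hb : ∀ (x : ℝ) (n : ℤ), n ≤ x → x < n + 1 → fractBump x = (x - n) * (1 - (x - n)) :=
    fun x n h1 h2 => fractBump_eq_of_floor (Int.floor_eq_iff.2 ⟨h1, h2⟩)
  interval_cases i
  · rw [hb _ 0 (by norm_num) (by norm_num), hb _ 0 (by norm_num) (by norm_num),
      hb _ 0 (by norm_num) (by norm_num)]
    norm_num
  · rw [hb _ 0 (by norm_num) (by norm_num), hb _ 0 (by norm_num) (by norm_num),
      hb _ 0 (by norm_num) (by norm_num)]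
    norm_num
  · rw [hb _ 0 (by norm_num) (by norm_num), hb _ 0 (by norm_num) (by norm_num),
      hb _ 1 (by norm_num) (by norm_num)]
    norm_num
  · rw [hb _ 0 (by norm_num) (by norm_num), hb _ 1 (by norm_num) (by norm_num),
      hb _ 1 (by norm_num) (by norm_num)]
    norm_num
  · rw [hb _ 0 (by norm_num) (by norm_num), hb _ 1 (by norm_num) (by norm_num),
      hb _ 2 (by norm_num) (by norm_num)]
    norm_num

end FractBump

/-! ### The three families of data -/

namespace KleinDatum

/-- The datum for a prime power `p ^ r` with `r ≥ 2`. -/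
def ofPrimePow {p r : ℕ} (hp : p.Prime) (hr : 2 ≤ r) : KleinDatum (p ^ r) where
  t := ![p ^ r - 1, p ^ (r - 1), 1]
  e := ![-1, -1, 1]
  pos := by
    have h1 : 1 < p ^ r := Nat.one_lt_pow (by omega) hp.one_lt
    have h2 : 0 < p ^ (r - 1) := pow_pos hp.pos _
    rw [Fin.forall_fin_succ, Fin.forall_fin_two]
    exact ⟨Nat.sub_pos_of_lt h1, h2, one_pos⟩
  lt := by
    have h1 : 1 < p ^ r := Nat.one_lt_pow (by omega) hp.one_lt
    have h2 : p ^ (r - 1) < p ^ r := Nat.pow_lt_pow_right hp.one_lt (by omega)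
    rw [Fin.forall_fin_succ, Fin.forall_fin_two]
    exact ⟨Nat.sub_lt (by omega) one_pos, h2, h1⟩
  sum_e := by simp [Fin.sum_univ_three]
  dvd := by
    obtain ⟨k, rfl⟩ : ∃ k, r = k + 2 := ⟨r - 2, by omega⟩
    have h1 : 1 ≤ p ^ (k + 2) := Nat.one_le_pow _ _ hp.pos
    -- With `N = p^(k+2)`, the sum is `-(N - 1)² - p^(2k+2) + 1`, and `p^(2k+2) = N p^k`; this is
    -- where `r ≥ 2` enters.
    refine ⟨-p ^ (k + 2) + 2 - p ^ k, ?_⟩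
    simp only [Fin.sum_univ_three, Matrix.cons_val]
    push_cast [h1]
    ring
  nonpos := by
    intro a
    have h1 : 1 ≤ p ^ r := Nat.one_le_pow _ _ hp.pos
    have hN : ((p ^ r : ℕ) : ℝ) ≠ 0 := Nat.cast_ne_zero.2 (by omega)
    -- The indices `N - 1` and `1` are opposite modulo `N` and carry opposite exponents, so their
    -- even periodic contributions cancel.
    have e : (((p ^ r - 1 : ℕ) : ℝ) * a / (p ^ r : ℕ)) = -(1 * a / (p ^ r : ℕ)) + a := by
      rw [Nat.cast_sub h1, Nat.cast_one]
      field_simp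
      ring
    have h2 := fractBump_nonneg (((p ^ (r - 1) : ℕ) : ℝ) * a / (p ^ r : ℕ))
    simp only [Fin.sum_univ_three, Matrix.cons_val]
    rw [e, fractBump_add_intCast, fractBump_neg]
    push_cast at h2 ⊢
    linarith

/-- The datum of level `5`. -/
def five {N : ℕ} (hN : N = 5) : KleinDatum N where
  t := ![1, 2, 3]
  e := ![2, -1, -2]
  pos := by
    rw [Fin.forall_fin_succ, Fin.forall_fin_two]
    exact ⟨one_pos, two_pos, three_pos⟩
  lt := by
    rw [Fin.forall_fin_succ, Fin.forall_fin_two]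
    subst hN
    exact ⟨show 1 < 5 by norm_num, show 2 < 5 by norm_num, show 3 < 5 by norm_num⟩
  sum_e := by simp [Fin.sum_univ_three]
  dvd := by
    subst hN
    refine ⟨-4, ?_⟩
    simp [Fin.sum_univ_three]
  nonpos := by
    intro a
    subst hN
    have h := fractBump_fifths a
    simp only [Fin.sum_univ_three, Matrix.cons_val]
    push_cast
    rw [one_mul]
    linarith

/-- The datum of level `N > 5`. -/
def ofFiveLT {N : ℕ} (hN : 5 < N) : KleinDatum N where
  t := ![3, 4, 5]
  e := ![-1, -1, 1]
  pos := by
    rw [Fin.forall_fin_succ, Fin.forall_fin_two]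
    exact ⟨three_pos, four_pos, show 0 < 5 by norm_num⟩
  lt := by
    rw [Fin.forall_fin_succ, Fin.forall_fin_two]
    exact ⟨show 3 < N by omega, show 4 < N by omega, hN⟩
  sum_e := by simp [Fin.sum_univ_three]
  dvd := by
    -- The sum vanishes: `-3² - 4² + 5² = 0`.
    refine ⟨0, ?_⟩
    simp [Fin.sum_univ_three]
  nonpos := by
    intro a
    have h := fractBump_five_le (a / N)
    simp only [Fin.sum_univ_three, Matrix.cons_val]
    push_cast
    simp only [mul_div_assoc]
    linarith

end KleinDatum

/-! ### Assembly of the theorem -/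

/-- The factors `1 - w` contribute `-2p^(r-1)` through `hsum`, and `N⁻²` contributes `-2r
p^(r-1)(p-1)`; together these give the stated minimum. -/
theorem exists_modularForm_of_kleinDatum {p r : ℕ} (hp : p.Prime) (hr : 1 ≤ r)
    (D : KleinDatum (p ^ r)) (hD : ∀ τ, D.form τ = kleinProduct p r τ) {ν : Fin 3 → ℤ}
    (hν : ∀ i, ∀ x : cycField (p ^ r), IsPrimitiveRoot x (p ^ r) →
      (piIdeal p r hp hr).valuation (cycField (p ^ r)) (1 - x ^ D.t i) = WithZero.exp (-ν i))
    (hsum : ∑ i, D.e i * ν i = -(p : ℤ) ^ (r - 1)) :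
    ∃ f : ModularForm ((CongruenceSubgroup.Gamma1 (p ^ r) : Subgroup SL(2, ℤ)) :
        Subgroup (GL (Fin 2) ℝ)) 2,
      (∀ τ : ℍ, f τ = kleinProduct p r τ) ∧
      (∃ a : PowerSeries ℤ,
        UpperHalfPlane.qExpansion 1 f = a.map (Int.castRingHom ℂ)) ∧
      ∀ α : SL(2, ℤ), α 0 0 = 0 →
        ∃ b : PowerSeries (cycField (p ^ r)),
          UpperHalfPlane.qExpansion ((p ^ r : ℕ) : ℝ) ((f : ℍ → ℂ) ∣[(2 : ℤ)] α) =
            b.map (algebraMap (cycField (p ^ r)) ℂ) ∧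
          IsLeast (Set.range fun n : ℕ => nuPi p r hp hr (PowerSeries.coeff n b))
            ((-2 * (p : ℤ) ^ (r - 1) * ((p : ℤ) * r - r + 1) : ℤ) : WithTop ℤ) := by
  refine ⟨D.modularForm, hD, D.exists_qExpansion_eq_map_int, fun α hα => ?_⟩
  obtain ⟨b, hb, hleast⟩ := D.exists_qExpansion_slash hp hr hν hα
  refine ⟨b, hb, ?_⟩
  convert hleast using 2
  rw [hsum]
  have := hp.one_le
  push_cast [this]
  ring

theorem mainTheorem6 (p r : ℕ) (hp : p.Prime) (hr : 1 ≤ r) (hpr : 3 < p ^ r) :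
    ∃ f : ModularForm ((CongruenceSubgroup.Gamma1 (p ^ r) : Subgroup SL(2, ℤ)) :
        Subgroup (GL (Fin 2) ℝ)) 2,
      (∀ τ : ℍ, f τ = kleinProduct p r τ) ∧
      (∃ a : PowerSeries ℤ,
        UpperHalfPlane.qExpansion 1 f = a.map (Int.castRingHom ℂ)) ∧
      ∀ α : SL(2, ℤ), α 0 0 = 0 →
        ∃ b : PowerSeries (cycField (p ^ r)),
          UpperHalfPlane.qExpansion ((p ^ r : ℕ) : ℝ) ((f : ℍ → ℂ) ∣[(2 : ℤ)] α) =
            b.map (algebraMap (cycField (p ^ r)) ℂ) ∧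
          IsLeast (Set.range fun n : ℕ => nuPi p r hp hr (PowerSeries.coeff n b))
            ((-2 * (p : ℤ) ^ (r - 1) * ((p : ℤ) * r - r + 1) : ℤ) : WithTop ℤ) := by
  rcases hr.lt_or_eq with h2 | h1
  · have hr2 : 2 ≤ r := h2
    -- The indices `p^r - 1` and `1` are prime to `p` and their valuations cancel in the sum; the
    -- middle index gives a root of order `p`, of valuation `p^(r-1)`.
    refine exists_modularForm_of_kleinDatum hp hr (KleinDatum.ofPrimePow hp hr2)
      (ν := ![1, p ^ (r - 1), 1]) (fun τ => ?_) ?_ ?_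
    · rw [KleinDatum.form_eq_prod_kleinAt, kleinProduct, if_pos hr2, Fin.prod_univ_three]
      simp [KleinDatum.ofPrimePow]
    · rw [Fin.forall_fin_succ, Fin.forall_fin_two]
      refine ⟨fun x hx => ?_, fun x hx => ?_, fun x hx => ?_⟩
      · refine piIdeal_valuation_one_sub hp hr (hx.pow_of_coprime _ ?_)
        have h1 : 1 ≤ p ^ r := by omega
        exact Nat.isCoprime_iff_coprime.1 ⟨-1, 1, by
          change -1 * ((p ^ r - 1 : ℕ) : ℤ) + 1 * ((p ^ r : ℕ) : ℤ) = 1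
          push_cast [h1]
          ring⟩
      · have hx' : IsPrimitiveRoot (x ^ p ^ (r - 1)) p :=
          hx.pow (pow_pos hp.pos _) (by rw [← pow_succ, Nat.sub_add_cancel hr])
        have := piIdeal_valuation_one_sub_of_order_prime hp hr hx'
        simpa [KleinDatum.ofPrimePow] using this
      · have := piIdeal_valuation_one_sub hp hr hx
        simpa [KleinDatum.ofPrimePow] using this
    · simp [Fin.sum_univ_three, KleinDatum.ofPrimePow]
  · subst h1
    -- At prime level every index lies strictly between `0` and `p`, so all valuations are `1` and
    -- their weighted sum is `∑ e = -1`.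
    have hν : ∀ D : KleinDatum (p ^ 1), ∀ i, ∀ x : cycField (p ^ 1), IsPrimitiveRoot x (p ^ 1) →
        (piIdeal p 1 hp hr).valuation (cycField (p ^ 1)) (1 - x ^ D.t i) =
          WithZero.exp (-(fun _ => 1 : Fin 3 → ℤ) i) := by
      intro D i x hx
      refine piIdeal_valuation_one_sub hp hr (hx.pow_of_coprime _ (Nat.Coprime.symm ?_))
      refine Nat.Coprime.pow_left 1 (hp.coprime_iff_not_dvd.2 ?_)
      have := (D.lt i).trans_eq (pow_one p)
      exact fun h => absurd (Nat.le_of_dvd (D.pos i) h) (not_le.2 this)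
    have hsum : ∀ D : KleinDatum (p ^ 1), ∑ i, D.e i * (fun _ => 1 : Fin 3 → ℤ) i =
        -(p : ℤ) ^ (1 - 1) := fun D => by simp [D.sum_e]
    by_cases h5 : p = 5
    · refine exists_modularForm_of_kleinDatum hp hr (KleinDatum.five (by rw [h5, pow_one]))
        (fun τ => ?_) (hν _) (hsum _)
      rw [KleinDatum.form_eq_prod_kleinAt, kleinProduct, if_neg (by norm_num), if_pos h5,
        Fin.prod_univ_three]
      subst h5
      simp [KleinDatum.five]
    · have h6 : 5 < p := by
        rw [pow_one] at hpr
        have : p ≠ 4 := by rintro rfl; exact absurd hp (by norm_num)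
        omega
      refine exists_modularForm_of_kleinDatum hp hr (KleinDatum.ofFiveLT (by rwa [pow_one]))
        (fun τ => ?_) (hν _) (hsum _)
      rw [KleinDatum.form_eq_prod_kleinAt, kleinProduct, if_neg (by norm_num), if_neg h5,
        Fin.prod_univ_three]
      simp [KleinDatum.ofFiveLT]
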